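/- Let $F$ be a field of characteristic different from $2$. For a unital, not necessarily associative $F$-algebra $A$ with a strong involution $*$ (a linear map with $(ab)^*=b^*a^*$, $(a^*)^*=a$, and $a^*=a$ if and only if $a\in F1$) and $\gamma\in F^\times$, the Dickson double $D_\gamma(A)=A\oplus iA$ is the algebra with multiplication $$(a+ib)(c+id)=(ac+\gamma\, d b^*)+i(a^*d+cb)$$ and strong involution $(a+ib)^*=a^*-ib$. Let $O$ be a Cayley algebra over $F$, i.e. an $8$-dimensional algebra with strong involution isomorphic to $D_\gamma(D_\beta(D_\alpha(F)))$ for some $\alpha,\beta,\gamma\in F^\times$, where $F$ carries the identity involution. Let $\tau(a)=\tfrac12(a+a^*)$ and $V=\mathrm{im}(O)=\ker\tau$. Subalgebras of $O$ are required to contain $1$; for a subalgebra $H$ put $\mathrm{im}(H)=H\cap V$. A linear subspace $A\subseteq O$ is called associative if $(xy)z=x(yz)$ for all $x,y,z\in A$ (the products need not lie in $A$). The algebra $O$ is a division algebra if for every nonzero $a\in O$ the maps $x\mapsto ax$ and $x\mapsto xa$ are bijective. 1. Let $A$ be a three-dimensional associative subspace of $O$ with $1\notin A$ (for example, any three-dimensional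 associative subspace of $V$). Then the sum $F1\oplus A$ is direct and closed under the multiplication of $O$, and it is a four-dimensional associative subalgebra of $O$. 2. Let $\mathcal B$ be the collection of all three-dimensional associative subspaces of $V$. Then $$\mathcal B=\{\mathrm{im}(H) : H \text{ is a four-dimensional subalgebra of } O\}.$$ 3. The pair $(V,\mathcal B)$ is a $(7,3,2)$-$q$-covering design: $\dim V=7$, every member of $\mathcal B$ is a three-dimensional subspace of $V$, and every two-dimensional subspace of $V$ is contained in at least one member of $\mathcal B$. It is locally minimal: no proper subcollection of $\mathcal B$ covers all two-dimensional subspaces of $V$. Moreover $(V,\mathcal B)$ is a $2$-$(7,3,1)$ subspace design (every two-dimensional subspace of $V$ is contained in exactly one member of $\mathcal B$) if and only if $O$ is a division algebra. -/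

import Mathlib

namespace CayleyDickson

section Algebras

variable (F : Type*) [Field F] (A : Type*) [NonAssocRing A] [Module F A]

/-- The line `F1` of scalar multiples of the unit element of a unital, not necessarily
associative algebra. -/
def scalars : Submodule F A := Submodule.span F {(1 : A)}

/-- A strong involution: a linear map `*` with `(ab)* = b* a*`, `(a*)* = a`, and with
`a* = a` if and only if `a ∈ F1`. -/
structure StrongInvolution extends A →ₗ[F] A where
  map_mul' : ∀ a b : A, toFun (a * b) = toFun b * toFun a
  invol' : ∀ a : A, toFun (toFun a) = a
  strong' : ∀ a : A, toFun a = a ↔ a ∈ scalars F A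

/-- A division algebra: left and right multiplication by every non-zero element are
invertible. -/
def IsDivisionAlgebra (A : Type*) [NonAssocRing A] : Prop :=
  ∀ a : A, a ≠ 0 →
    Function.Bijective (fun x : A => a * x) ∧ Function.Bijective (fun x : A => x * a)

end Algebras

section Subspaces

variable {F : Type*} [Field F] {A : Type*} [NonAssocRing A] [Module F A]

/-- A subspace is a (unital) subalgebra if it contains `1` and is closed under
multiplication. -/
def IsSubalgebra (H : Submodule F A) : Prop :=
  (1 : A) ∈ H ∧ ∀ x ∈ H, ∀ y ∈ H, x * y ∈ H

/-- An associative subspace: the associator vanishes on it. The products themselves need not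
lie in the subspace. -/
def IsAssociativeSubspace (V : Submodule F A) : Prop :=
  ∀ x ∈ V, ∀ y ∈ V, ∀ z ∈ V, (x * y) * z = x * (y * z)

namespace StrongInvolution

variable (σ : StrongInvolution F A)

/-- The projection `τ(a) = (a + a*) / 2` onto `F1`, regarded as a map `A → A`. -/
def tau : A →ₗ[F] A := (2⁻¹ : F) • (LinearMap.id + σ.toLinearMap)

/-- The space `im(A) = ker τ` of imaginary elements. -/
def im : Submodule F A := LinearMap.ker σ.tau

/-- The imaginary part `im(H) = H ∩ im(A)` of a subalgebra `H`. -/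
def imOf (H : Submodule F A) : Submodule F A := H ⊓ σ.im

theorem map_one : σ.toLinearMap (1 : A) = 1 :=
  (σ.strong' 1).2 (Submodule.subset_span rfl)

end StrongInvolution

end Subspaces

section Designs

variable {F : Type*} [Field F] {E : Type*} [AddCommGroup E] [Module F E]

/-- A `(v, k, t)`-`q`-covering design on the space `V`: a collection of `k`-dimensional subspaces
of the `v`-dimensional space `V` such that every `t`-dimensional subspace of `V` is contained in
at least one of them. All spaces are given as subspaces of an ambient space `E`. -/
def IsQCoveringDesign (v k t : ℕ) (V : Submodule F E) (B : Set (Submodule F E)) : Prop :=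
  (FiniteDimensional F V ∧ Module.finrank F V = v) ∧
  (∀ b ∈ B, b ≤ V ∧ Module.finrank F b = k) ∧
  ∀ T : Submodule F E, T ≤ V → Module.finrank F T = t → ∃ b ∈ B, T ≤ b

/-- A `t`-`(v, k, l)` subspace design on the space `V`: a collection of `k`-dimensional subspaces
of the `v`-dimensional space `V` such that every `t`-dimensional subspace of `V` is contained in
exactly `l` of them. -/
def IsSubspaceDesign (t v k l : ℕ) (V : Submodule F E) (B : Set (Submodule F E)) : Prop :=
  (FiniteDimensional F V ∧ Module.finrank F V = v) ∧
  (∀ b ∈ B, b ≤ V ∧ Module.finrank F b = k) ∧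
  ∀ T : Submodule F E, T ≤ V → Module.finrank F T = t → {b ∈ B | T ≤ b}.encard = l

end Designs

/-- The underlying space of the Dickson double `D_γ(A) = A ⊕ iA`; the pair `⟨a, b⟩` stands
for `a + ib`. -/
@[ext]
structure DicksonDouble {F : Type*} [Field F] {A : Type*} [NonAssocRing A] [Module F A]
    (σ : StrongInvolution F A) (γ : F) where
  fst : A
  snd : A

namespace DicksonDouble

variable {F : Type*} [Field F] {A : Type*} [NonAssocRing A] [Module F A]
  {σ : StrongInvolution F A} {γ : F}

instance : Zero (DicksonDouble σ γ) := ⟨⟨0, 0⟩⟩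
instance : One (DicksonDouble σ γ) := ⟨⟨1, 0⟩⟩
instance : Add (DicksonDouble σ γ) := ⟨fun x y => ⟨x.fst + y.fst, x.snd + y.snd⟩⟩
instance : Neg (DicksonDouble σ γ) := ⟨fun x => ⟨-x.fst, -x.snd⟩⟩
instance : SMul F (DicksonDouble σ γ) := ⟨fun r x => ⟨r • x.fst, r • x.snd⟩⟩

/-- `(a + ib)(c + id) = (ac + γ d b*) + i(a* d + c b)`. -/
instance : Mul (DicksonDouble σ γ) :=
  ⟨fun x y => ⟨x.fst * y.fst + γ • (y.snd * σ.toLinearMap x.snd),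
    σ.toLinearMap x.fst * y.snd + y.fst * x.snd⟩⟩

@[simp] theorem fst_zero : (0 : DicksonDouble σ γ).fst = 0 := rfl
@[simp] theorem snd_zero : (0 : DicksonDouble σ γ).snd = 0 := rfl
@[simp] theorem fst_one : (1 : DicksonDouble σ γ).fst = 1 := rfl
@[simp] theorem snd_one : (1 : DicksonDouble σ γ).snd = 0 := rfl
@[simp] theorem fst_add (x y : DicksonDouble σ γ) : (x + y).fst = x.fst + y.fst := rfl
@[simp] theorem snd_add (x y : DicksonDouble σ γ) : (x + y).snd = x.snd + y.snd := rfl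
@[simp] theorem fst_neg (x : DicksonDouble σ γ) : (-x).fst = -x.fst := rfl
@[simp] theorem snd_neg (x : DicksonDouble σ γ) : (-x).snd = -x.snd := rfl
@[simp] theorem fst_smul (r : F) (x : DicksonDouble σ γ) : (r • x).fst = r • x.fst := rfl
@[simp] theorem snd_smul (r : F) (x : DicksonDouble σ γ) : (r • x).snd = r • x.snd := rfl
@[simp] theorem fst_mul (x y : DicksonDouble σ γ) :
    (x * y).fst = x.fst * y.fst + γ • (y.snd * σ.toLinearMap x.snd) := rfl
@[simp] theorem snd_mul (x y : DicksonDouble σ γ) :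
    (x * y).snd = σ.toLinearMap x.fst * y.snd + y.fst * x.snd := rfl

theorem conj_mul (a b : A) :
    σ.toLinearMap (a * b) = σ.toLinearMap b * σ.toLinearMap a := σ.map_mul' a b
theorem conj_conj (a : A) : σ.toLinearMap (σ.toLinearMap a) = a := σ.invol' a
theorem conj_add (a b : A) : σ.toLinearMap (a + b) = σ.toLinearMap a + σ.toLinearMap b := σ.map_add' a b
theorem conj_smul (r : F) (a : A) : σ.toLinearMap (r • a) = r • σ.toLinearMap a := σ.map_smul' r a
theorem conj_zero : σ.toLinearMap (0 : A) = 0 := map_zero σ.toLinearMap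
theorem conj_neg (a : A) : σ.toLinearMap (-a) = -σ.toLinearMap a := map_neg σ.toLinearMap a

instance : AddCommGroup (DicksonDouble σ γ) where
  add_assoc x y z := by ext <;> simp [add_assoc]
  zero_add x := by ext <;> simp
  add_zero x := by ext <;> simp
  add_comm x y := by ext <;> simp [add_comm]
  neg_add_cancel x := by ext <;> simp
  nsmul := nsmulRec
  zsmul := zsmulRec

instance : NonAssocRing (DicksonDouble σ γ) where
  left_distrib x y z := by
    ext <;> simp only [fst_mul, snd_mul, fst_add, snd_add, mul_add, add_mul, smul_add] <;> abel
  right_distrib x y z := by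
    ext <;> simp only [fst_mul, snd_mul, fst_add, snd_add, mul_add, add_mul, smul_add, conj_add]
      <;> abel
  zero_mul x := by ext <;> simp [conj_zero]
  mul_zero x := by ext <;> simp
  one_mul x := by ext <;> simp [conj_zero, σ.map_one]
  mul_one x := by ext <;> simp

instance : Module F (DicksonDouble σ γ) where
  one_smul x := by ext <;> simp
  mul_smul r s x := by ext <;> simp [mul_smul]
  smul_zero r := by ext <;> simp
  smul_add r x y := by ext <;> simp
  add_smul r s x := by ext <;> simp [add_smul]
  zero_smul x := by ext <;> simp

variable [SMulCommClass F A A] [IsScalarTower F A A]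

instance : SMulCommClass F (DicksonDouble σ γ) (DicksonDouble σ γ) where
  smul_comm r x y := by
    ext <;> simp [mul_smul_comm, smul_mul_assoc, smul_comm r γ]

instance : IsScalarTower F (DicksonDouble σ γ) (DicksonDouble σ γ) where
  smul_assoc r x y := by
    ext <;> simp [mul_smul_comm, smul_mul_assoc, smul_comm r γ]

variable [NeZero (2 : F)]

variable (σ γ) in
/-- The involution `(a + ib)* = a* - ib` of the Dickson double: it extends `*` and sends `i`
to `-i`. -/
def conj : StrongInvolution F (DicksonDouble σ γ) where
  toFun x := ⟨σ.toLinearMap x.fst, -x.snd⟩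
  map_add' x y := by ext <;> simp [add_comm, conj_add]
  map_smul' r x := by ext <;> simp
  map_mul' x y := by
    ext
    · simp [conj_add, conj_mul, conj_conj]
    · simp [conj_conj, add_comm]
  invol' x := by ext <;> simp [conj_conj]
  strong' x := by
    have h2 : (2 : F) ≠ 0 := NeZero.ne _
    have hs := σ.strong' x.fst
    rw [scalars, Submodule.mem_span_singleton] at hs ⊢
    constructor
    · intro h
      have h0 : σ.toLinearMap x.fst = x.fst := congrArg fst h
      have h1 : -x.snd = x.snd := congrArg snd h
      obtain ⟨r, hr⟩ := hs.1 h0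
      refine ⟨r, ?_⟩
      have h3 : (2 : F) • x.snd = 0 := by
        rw [two_smul]
        nth_rewrite 1 [← h1]
        exact neg_add_cancel _
      have h4 : x.snd = 0 := (smul_eq_zero.1 h3).resolve_left h2
      ext
      · simpa using hr
      · simp [h4]
    · rintro ⟨r, rfl⟩
      ext <;> simp [σ.map_one]

end DicksonDouble

section Cayley

variable (F : Type*) [Field F]

/-- The identity map of the one-dimensional algebra `F`. -/
def baseInvolution : StrongInvolution F F where
  toLinearMap := LinearMap.id
  map_mul' a b := mul_comm a b
  invol' _ := rfl
  strong' a :=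
    ⟨fun _ => Submodule.mem_span_singleton.2 ⟨a, by simp⟩, fun _ => rfl⟩

variable [NeZero (2 : F)]

variable {F} in
/-- The strong involution of `D_α(F)`. -/
abbrev involution₂ (α : F) := DicksonDouble.conj (baseInvolution F) α

variable {F} in
/-- The strong involution of `D_β(D_α(F))`. -/
abbrev involution₄ (α β : F) := DicksonDouble.conj (involution₂ α) β

variable {F} in
/-- The strong involution of `D_γ(D_β(D_α(F)))`. -/
abbrev involution₈ (α β γ : F) := DicksonDouble.conj (involution₄ α β) γ

/-- A Cayley algebra, that is, an 8-dimensional Cayley-Dickson algebra: an algebra with strong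
involution which is isomorphic, as an algebra with involution, to a threefold iterated Dickson
double `D_γ(D_β(D_α(F)))` with non-zero `α`, `β`, `γ`. -/
def IsCayleyAlgebra {F : Type*} [Field F] [NeZero (2 : F)] {O : Type*} [NonAssocRing O]
    [Module F O] (σ : StrongInvolution F O) : Prop :=
  ∃ α β γ : F, α ≠ 0 ∧ β ≠ 0 ∧ γ ≠ 0 ∧
    ∃ e : O ≃ₗ[F] DicksonDouble (involution₄ α β) γ,
      (∀ x y : O, e (x * y) = e x * e y) ∧
      ∀ x : O, e (σ.toLinearMap x) = (involution₈ α β γ).toLinearMap (e x)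

end Cayley

section Blocks

variable {F : Type*} [Field F] {O : Type*} [NonAssocRing O] [Module F O]

/-- The imaginary parts of the four-dimensional subalgebras. -/
def subalgebraBlocks (σ : StrongInvolution F O) : Set (Submodule F O) :=
  {B | ∃ H : Submodule F O, IsSubalgebra H ∧ Module.finrank F H = 4 ∧ B = σ.imOf H}

/-- The three-dimensional associative subspaces of the space of imaginary elements. -/
def associativeBlocks (σ : StrongInvolution F O) : Set (Submodule F O) :=
  {B | B ≤ σ.im ∧ Module.finrank F B = 3 ∧ IsAssociativeSubspace B}

end Blocks

end CayleyDickson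

/-! The multiplication is controlled by the nondegenerate symmetric form `b` with `x x* = b(x, x) 1`
and by one identity, `associator_mul`. For imaginary `x, y, z, a` it expresses the imaginary part of
`[x, y, z] a` through `x, y, z` and the imaginary parts of `yz, zx, xy`, with coefficients `b(·,
a)`. It is checked in coordinates on the iterated double and transported to `O`.

Associative subspaces and subalgebras. Let `W` contain `1` and have dimension four. If `W` is
associative but `yz ∉ W`, an `a` orthogonal to `W` with `b(yz, a) ≠ 0` turns the identity into `x ∈
span {y, z}` for every imaginary `x` in `W`, which contradicts the dimension. If `W` is a
subalgebra, an anisotropic `n` orthogonal to `W` makes the right-hand side vanish, so `[x, y, z] n =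
0` and hence `[x, y, z] = 0`.

Covering. For fixed imaginary `x, y` the form `b([x, y, z], w)` is skew in `z, w` and has `1, x, y`
in its radical. A complement of their span has dimension five, which is odd, so the radical contains
a further `z`, and `span {x, y, z}` is a block.

Minimality. If `xy ∉ span {1, x, y}`, at most one block contains `x` and `y`, because its sum with
`F1` must be the span of `1, x, y, xy`. Every block contains such a pair: otherwise its
multiplication is identically zero (`mul_eq_zero_of_mul_mem_span`), which no three-dimensional
imaginary space allows (`not_mul_eq_zero`).

Division algebras are those with anisotropic `b`. In that case `xy ∉ span {1, x, y}` for all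
independent imaginary `x, y`, so blocks are unique. An isotropic vector instead produces a plane
with zero multiplication lying in two blocks. -/

set_option linter.unusedSectionVars false

/-! ### The form of a Cayley algebra, verified in coordinates -/

namespace CayleyDickson

/-- The structure of a Cayley algebra used below: a nondegenerate symmetric bilinear form `b` with
`x x* = b(x, x) 1`, together with the identities it satisfies. -/
structure IsCayleyForm {F : Type*} [Field F] {O : Type*} [NonAssocRing O] [Module F O]
    (σ : StrongInvolution F O) (b : LinearMap.BilinForm F O) : Prop where
  finrank_eq : Module.finrank F O = 8
  symm : ∀ x y, b x y = b y x
  nondeg : ∀ x, (∀ y, b x y = 0) → x = 0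
  one_one : b 1 1 = 1
  conj_eq : ∀ x, σ.toLinearMap x = (2 * b x 1) • (1 : O) - x
  conj_mul_mul : ∀ x y, σ.toLinearMap x * (x * y) = b x x • y
  mul_mul_conj : ∀ x y, (y * x) * σ.toLinearMap x = b x x • y
  mul_left : ∀ x y z, b (x * y) z = b y (σ.toLinearMap x * z)
  mul_right : ∀ x y z, b (x * y) z = b x (z * σ.toLinearMap y)
  associator_mul : ∀ x y z a, b x 1 = 0 → b y 1 = 0 → b z 1 = 0 → b a 1 = 0 →
    associator x y z * a + b (associator x y z) a • (1 : O) =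
      (2 : F) • (b (y * z) a • x + b (z * x) a • y + b (x * y) a • z -
        (b x a • (y * z + b y z • (1 : O)) + b y a • (z * x + b z x • (1 : O)) +
          b z a • (x * y + b x y • (1 : O))))

namespace DicksonDouble

variable {F : Type*} [Field F] {A : Type*} [NonAssocRing A] [Module F A]
  {σ : StrongInvolution F A} {γ : F}

@[simp] theorem fst_sub (x y : DicksonDouble σ γ) : (x - y).fst = x.fst - y.fst := by
  simp [sub_eq_add_neg]
@[simp] theorem snd_sub (x y : DicksonDouble σ γ) : (x - y).snd = x.snd - y.snd := by
  simp [sub_eq_add_neg]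

theorem mk_mul_mk (a b c d : A) : (⟨a, b⟩ * ⟨c, d⟩ : DicksonDouble σ γ) =
    ⟨a * c + γ • (d * σ.toLinearMap b), σ.toLinearMap a * d + c * b⟩ := rfl
theorem mk_add_mk (a b c d : A) : (⟨a, b⟩ + ⟨c, d⟩ : DicksonDouble σ γ) = ⟨a + c, b + d⟩ := rfl
theorem neg_mk (a b : A) : -(⟨a, b⟩ : DicksonDouble σ γ) = ⟨-a, -b⟩ := rfl
theorem smul_mk (r : F) (a b : A) : r • (⟨a, b⟩ : DicksonDouble σ γ) = ⟨r • a, r • b⟩ := rfl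
theorem one_def : (1 : DicksonDouble σ γ) = ⟨1, 0⟩ := rfl

/-- The Dickson double is linearly the product of two copies of the algebra. -/
def prodEquiv (σ : StrongInvolution F A) (γ : F) : DicksonDouble σ γ ≃ₗ[F] A × A where
  toFun x := (x.fst, x.snd)
  invFun x := ⟨x.1, x.2⟩
  map_add' _ _ := rfl
  map_smul' _ _ := rfl
  left_inv _ := rfl
  right_inv _ := rfl

instance [FiniteDimensional F A] : FiniteDimensional F (DicksonDouble σ γ) :=
  (prodEquiv σ γ).symm.finiteDimensional

theorem finrank_eq [FiniteDimensional F A] :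
    Module.finrank F (DicksonDouble σ γ) = 2 * Module.finrank F A := by
  rw [(prodEquiv σ γ).finrank_eq, Module.finrank_prod, two_mul]

/-- The form `b(a + ib, c + id) = b(a, c) - γ b(b, d)`. -/
def form (σ : StrongInvolution F A) (γ : F) (b : LinearMap.BilinForm F A) :
    LinearMap.BilinForm F (DicksonDouble σ γ) :=
  LinearMap.mk₂ F (fun x y => b x.fst y.fst - γ * b x.snd y.snd)
    (by intros; simp; ring) (by intros; simp; ring) (by intros; simp; ring)
    (by intros; simp; ring)

@[simp] theorem form_apply (b : LinearMap.BilinForm F A) (x y : DicksonDouble σ γ) :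
    form σ γ b x y = b x.fst y.fst - γ * b x.snd y.snd := rfl

theorem form_nondeg {b : LinearMap.BilinForm F A} (hγ : γ ≠ 0)
    (hb : ∀ x, (∀ y, b x y = 0) → x = 0) (x : DicksonDouble σ γ)
    (hx : ∀ y, form σ γ b x y = 0) : x = 0 := by
  ext
  · exact hb _ fun y => by simpa using hx ⟨y, 0⟩
  · exact hb _ fun y => by simpa [hγ] using hx ⟨0, y⟩

variable [SMulCommClass F A A] [IsScalarTower F A A] [NeZero (2 : F)]

omit [SMulCommClass F A A] [IsScalarTower F A A] in
theorem conj_mk (a b : A) : (conj σ γ).toLinearMap ⟨a, b⟩ = ⟨σ.toLinearMap a, -b⟩ := rfl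
omit [SMulCommClass F A A] [IsScalarTower F A A] in
@[simp] theorem fst_conj (x : DicksonDouble σ γ) :
    ((conj σ γ).toLinearMap x).fst = σ.toLinearMap x.fst := rfl
omit [SMulCommClass F A A] [IsScalarTower F A A] in
@[simp] theorem snd_conj (x : DicksonDouble σ γ) : ((conj σ γ).toLinearMap x).snd = -x.snd := rfl

end DicksonDouble

open DicksonDouble

@[simp] theorem baseInvolution_apply {F : Type*} [Field F] (x : F) :
    (baseInvolution F).toLinearMap x = x := rfl

/-- The symmetric bilinear form of the threefold Dickson double of `F`. -/
def form₈ {F : Type*} [Field F] [NeZero (2 : F)] (α β γ : F) :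
    LinearMap.BilinForm F (DicksonDouble (involution₄ α β) γ) :=
  form _ γ (form _ β (form _ α (LinearMap.mul F F)))

-- Apart from dimension and nondegeneracy, each field is a polynomial identity in the eight
-- coordinates of each vector and the parameters. Nondegeneracy passes through each doubling because
-- the parameters are nonzero.
set_option maxHeartbeats 4000000 in
theorem isCayleyForm_form₈ {F : Type*} [Field F] [NeZero (2 : F)] {α β γ : F}
    (hα : α ≠ 0) (hβ : β ≠ 0) (hγ : γ ≠ 0) :
    IsCayleyForm (involution₈ α β γ) (form₈ α β γ) where
  finrank_eq := by simp [DicksonDouble.finrank_eq]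
  symm x y := by simp [form₈]; ring
  nondeg := form_nondeg hγ (form_nondeg hβ (form_nondeg hα fun x hx => by simpa using hx 1))
  one_one := by simp [form₈]
  conj_eq x := by ext <;> simp [form₈]; ring
  conj_mul_mul x y := by ext <;> simp [form₈] <;> ring
  mul_mul_conj x y := by ext <;> simp [form₈] <;> ring
  mul_left x y z := by simp [form₈]; ring
  mul_right x y z := by simp [form₈]; ring
  associator_mul x y z a hx hy hz ha := by
    obtain ⟨⟨⟨x0, x1⟩, ⟨x2, x3⟩⟩, ⟨⟨x4, x5⟩, ⟨x6, x7⟩⟩⟩ := x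
    obtain ⟨⟨⟨y0, y1⟩, ⟨y2, y3⟩⟩, ⟨⟨y4, y5⟩, ⟨y6, y7⟩⟩⟩ := y
    obtain ⟨⟨⟨z0, z1⟩, ⟨z2, z3⟩⟩, ⟨⟨z4, z5⟩, ⟨z6, z7⟩⟩⟩ := z
    obtain ⟨⟨⟨a0, a1⟩, ⟨a2, a3⟩⟩, ⟨⟨a4, a5⟩, ⟨a6, a7⟩⟩⟩ := a
    simp only [form₈, form_apply, fst_one, snd_one, map_zero, mul_zero, sub_zero,
      LinearMap.mul_apply', mul_one] at hx hy hz ha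
    -- Being orthogonal to `1` means that the first coordinate is zero.
    subst hx hy hz ha
    simp only [form₈, form_apply, LinearMap.mul_apply', associator, sub_eq_add_neg, mk_mul_mk,
      mk_add_mk, neg_mk, smul_mk, conj_mk, one_def, baseInvolution_apply, smul_eq_mul,
      DicksonDouble.mk.injEq, mul_zero, zero_mul, smul_zero, add_zero, zero_add, mul_one]
    refine ⟨⟨⟨?_, ?_⟩, ?_, ?_⟩, ⟨?_, ?_⟩, ?_, ?_⟩ <;> ring

/-- A Cayley algebra carries a Cayley form. -/
theorem IsCayleyAlgebra.exists_form {F : Type*} [Field F] [NeZero (2 : F)] {O : Type*}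
    [NonAssocRing O] [Module F O] {σ : StrongInvolution F O} (hO : IsCayleyAlgebra σ) :
    ∃ b : LinearMap.BilinForm F O, IsCayleyForm σ b := by
  obtain ⟨α, β, γ, hα, hβ, hγ, e, he, hσ⟩ := hO
  have h := isCayleyForm_form₈ hα hβ hγ
  have e1 : e 1 = 1 := by
    have := he (e.symm 1) 1
    simpa using this.symm
  refine ⟨(form₈ α β γ).compl₁₂ e.toLinearMap e.toLinearMap, ?_⟩
  constructor
  · rw [e.finrank_eq, h.finrank_eq]
  · intro x y; exact h.symm _ _
  · intro x hx
    refine e.map_eq_zero_iff.1 (h.nondeg _ fun y => ?_)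
    simpa using hx (e.symm y)
  · simpa [e1] using h.one_one
  · intro x; apply e.injective; simpa [e1, hσ] using h.conj_eq (e x)
  · intro x y; apply e.injective; simpa [he, hσ] using h.conj_mul_mul (e x) (e y)
  · intro x y; apply e.injective; simpa [he, hσ] using h.mul_mul_conj (e x) (e y)
  · intro x y z; simpa [he, hσ] using h.mul_left (e x) (e y) (e z)
  · intro x y z; simpa [he, hσ] using h.mul_right (e x) (e y) (e z)
  · intro x y z a hx hy hz ha
    apply e.injective
    have := h.associator_mul (e x) (e y) (e z) (e a) (by simpa [e1] using hx)
      (by simpa [e1] using hy) (by simpa [e1] using hz) (by simpa [e1] using ha)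
    simpa [he, e1, associator] using this

end CayleyDickson

/-! ### Multilinearity of the associator -/

namespace CayleyDickson

open Module Submodule

section Associator

variable {F : Type*} [Field F] {O : Type*} [NonAssocRing O] [Module F O]

theorem isAssociativeSubspace_iff {W : Submodule F O} :
    IsAssociativeSubspace W ↔ ∀ x ∈ W, ∀ y ∈ W, ∀ z ∈ W, associator x y z = 0 := by
  simp only [IsAssociativeSubspace, associator, sub_eq_zero]

theorem associator_add_left (x y z w : O) :
    associator (x + y) z w = associator x z w + associator y z w := by
  simp only [associator, add_mul]; abel

theorem associator_add_mid (x y z w : O) :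
    associator x (y + z) w = associator x y w + associator x z w := by
  simp only [associator, add_mul, mul_add]; abel

theorem associator_add_right (x y z w : O) :
    associator x y (z + w) = associator x y z + associator x y w := by
  simp only [associator, mul_add]; abel

variable [SMulCommClass F O O] [IsScalarTower F O O]

theorem associator_smul_left (r : F) (x y z : O) :
    associator (r • x) y z = r • associator x y z := by
  simp [associator, smul_mul_assoc, smul_sub]

theorem associator_smul_mid (r : F) (x y z : O) :
    associator x (r • y) z = r • associator x y z := by
  simp [associator, smul_mul_assoc, mul_smul_comm, smul_sub]

theorem associator_smul_right (r : F) (x y z : O) :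
    associator x y (r • z) = r • associator x y z := by
  simp [associator, mul_smul_comm, smul_sub]

theorem associator_smul_one_left (r : F) (y z : O) : associator (r • (1 : O)) y z = 0 := by
  simp [associator, smul_mul_assoc]

theorem associator_smul_one_mid (r : F) (y z : O) : associator y (r • (1 : O)) z = 0 := by
  simp [associator, smul_mul_assoc, mul_smul_comm]

theorem associator_smul_one_right (r : F) (y z : O) : associator y z (r • (1 : O)) = 0 := by
  simp [associator, mul_smul_comm]

/-- Associativity of a subspace may be checked on a spanning set. -/
theorem isAssociativeSubspace_span {S : Set O}
    (h : ∀ x ∈ S, ∀ y ∈ S, ∀ z ∈ S, associator x y z = 0) :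
    IsAssociativeSubspace (span F S) := by
  rw [isAssociativeSubspace_iff]
  intro x hx y hy z hz
  induction hx using span_induction with
  | zero => simp [associator]
  | add u v _ _ hu hv => rw [associator_add_left, hu, hv, add_zero]
  | smul r u _ hu => rw [associator_smul_left, hu, smul_zero]
  | mem x hx =>
    induction hy using span_induction with
    | zero => simp [associator]
    | add u v _ _ hu hv => rw [associator_add_mid, hu, hv, add_zero]
    | smul r u _ hu => rw [associator_smul_mid, hu, smul_zero]
    | mem y hy =>
      induction hz using span_induction with
      | zero => simp [associator]
      | add u v _ _ hu hv => rw [associator_add_right, hu, hv, add_zero]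
      | smul r u _ hu => rw [associator_smul_right, hu, smul_zero]
      | mem z hz => exact h x hx y hy z hz

end Associator

/-! ### Alternativity and adjoint identities for imaginary elements -/

namespace IsCayleyForm

variable {F : Type*} [Field F] [NeZero (2 : F)] {O : Type*} [NonAssocRing O] [Module F O]
  {σ : StrongInvolution F O} {b : LinearMap.BilinForm F O} (h : IsCayleyForm σ b)

include h

theorem finiteDimensional : FiniteDimensional F O :=
  FiniteDimensional.of_finrank_pos (by rw [h.finrank_eq]; norm_num)

theorem one_ne_zero : (1 : O) ≠ 0 := fun h1 => by simpa [h1] using h.one_one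

theorem mem_im {x : O} : x ∈ σ.im ↔ b x 1 = 0 := by
  have h2 : (2 : F) ≠ 0 := NeZero.ne _
  have : σ.tau x = b x 1 • (1 : O) := by
    simp only [StrongInvolution.tau, h.conj_eq, LinearMap.smul_apply, LinearMap.add_apply,
      LinearMap.id_apply]
    rw [add_sub_cancel, smul_smul, inv_mul_cancel_left₀ h2]
  rw [StrongInvolution.im, LinearMap.mem_ker, this, smul_eq_zero, or_iff_left h.one_ne_zero]

theorem exists_im (x : O) : ∃ r : F, ∃ y ∈ σ.im, x = r • (1 : O) + y :=
  ⟨b x 1, x - b x 1 • 1, h.mem_im.2 (by simp [h.one_one]), by abel⟩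

theorem one_notMem_im : (1 : O) ∉ σ.im := by
  rw [h.mem_im, h.one_one]; exact _root_.one_ne_zero

theorem conj_of_mem_im {x : O} (hx : x ∈ σ.im) : σ.toLinearMap x = -x := by
  rw [h.conj_eq, h.mem_im.1 hx]; simp

theorem mul_mul_left {x : O} (hx : x ∈ σ.im) (y : O) : x * (x * y) = -(b x x • y) := by
  rw [← h.conj_mul_mul x y, h.conj_of_mem_im hx, neg_mul, neg_neg]

theorem mul_mul_right {x : O} (hx : x ∈ σ.im) (y : O) : (y * x) * x = -(b x x • y) := by
  rw [← h.mul_mul_conj x y, h.conj_of_mem_im hx, mul_neg, neg_neg]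

theorem mul_self {x : O} (hx : x ∈ σ.im) : x * x = -(b x x • (1 : O)) := by
  simpa using h.mul_mul_left hx 1

theorem mul_mul_add_left {x y : O} (hx : x ∈ σ.im) (hy : y ∈ σ.im) (z : O) :
    x * (y * z) + y * (x * z) = -((2 * b x y) • z) := by
  have h1 := h.mul_mul_left (add_mem hx hy) z
  simp only [add_mul, mul_add, h.mul_mul_left hx, h.mul_mul_left hy, map_add,
    LinearMap.add_apply, h.symm y x] at h1
  linear_combination (norm := module) h1

theorem mul_mul_add_right {x y : O} (hx : x ∈ σ.im) (hy : y ∈ σ.im) (z : O) :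
    (z * x) * y + (z * y) * x = -((2 * b x y) • z) := by
  have h1 := h.mul_mul_right (add_mem hx hy) z
  simp only [add_mul, mul_add, h.mul_mul_right hx, h.mul_mul_right hy, map_add,
    LinearMap.add_apply, h.symm y x] at h1
  linear_combination (norm := module) h1

theorem mul_add_mul {x y : O} (hx : x ∈ σ.im) (hy : y ∈ σ.im) :
    x * y + y * x = -((2 * b x y) • (1 : O)) := by
  simpa using h.mul_mul_add_left hx hy 1

theorem form_mul_left {x : O} (hx : x ∈ σ.im) (y z : O) : b (x * y) z = -b y (x * z) := by
  rw [h.mul_left, h.conj_of_mem_im hx, neg_mul, map_neg]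

theorem form_mul_right {y : O} (hy : y ∈ σ.im) (x z : O) : b (x * y) z = -b x (z * y) := by
  rw [h.mul_right, h.conj_of_mem_im hy, mul_neg, map_neg]

theorem form_mul_cycle {x z : O} (hx : x ∈ σ.im) (hz : z ∈ σ.im) (y : O) :
    b (x * y) z = b (y * z) x := by
  rw [h.form_mul_left hx, h.form_mul_right hz]

theorem form_mul_self_right {x y : O} (hx : x ∈ σ.im) (hy : y ∈ σ.im) : b (x * y) y = 0 := by
  rw [h.form_mul_cycle hx hy, h.mul_self hy, map_neg, map_smul, LinearMap.neg_apply,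
    LinearMap.smul_apply, h.symm 1 x, h.mem_im.1 hx]; simp

theorem form_mul_one {x : O} (hx : x ∈ σ.im) (y : O) : b (x * y) 1 = -b x y := by
  rw [h.form_mul_left hx, mul_one, h.symm]

variable [SMulCommClass F O O] [IsScalarTower F O O]

theorem associator_swap_left {x y : O} (hx : x ∈ σ.im) (hy : y ∈ σ.im) (z : O) :
    associator x y z = -associator y x z := by
  have h1 := h.mul_mul_add_left hx hy z
  have h2 : (x * y) * z + (y * x) * z = -((2 * b x y) • z) := by
    rw [← add_mul, h.mul_add_mul hx hy, neg_mul, smul_mul_assoc, one_mul]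
  simp only [associator]
  linear_combination (norm := module) h2 - h1

theorem associator_swap_right {x y : O} (hx : x ∈ σ.im) (hy : y ∈ σ.im) (z : O) :
    associator z x y = -associator z y x := by
  have h1 := h.mul_mul_add_right hx hy z
  have h2 : z * (x * y) + z * (y * x) = -((2 * b x y) • z) := by
    rw [← mul_add, h.mul_add_mul hx hy, mul_neg, mul_smul_comm, mul_one]
  simp only [associator]
  linear_combination (norm := module) h1 - h2

theorem associator_self_left {x : O} (hx : x ∈ σ.im) (y : O) : associator x x y = 0 := by
  rw [associator, h.mul_mul_left hx, h.mul_self hx, neg_mul, smul_mul_assoc, one_mul, sub_self]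

theorem associator_self_right {x : O} (hx : x ∈ σ.im) (y : O) : associator y x x = 0 := by
  rw [associator, h.mul_mul_right hx, h.mul_self hx, mul_neg, mul_smul_comm, mul_one, sub_self]

theorem associator_self_mid {x y : O} (hx : x ∈ σ.im) (hy : y ∈ σ.im) :
    associator x y x = 0 := by
  rw [h.associator_swap_left hx hy, h.associator_self_right hx, neg_zero]

/-- Left multiplications by `xy` and by `yx = (xy)*` are adjoint, so moving the factors across `b`
replaces `[x, y, ·]` by `[y, x, ·]`; alternativity then supplies the sign. -/
theorem form_associator {x y : O} (hx : x ∈ σ.im) (hy : y ∈ σ.im) (z w : O) :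
    b (associator x y z) w = -b (associator x y w) z := by
  have e : σ.toLinearMap (x * y) = y * x := by
    rw [show σ.toLinearMap (x * y) = _ from σ.map_mul' x y]
    exact (congrArg₂ (· * ·) (h.conj_of_mem_im hy) (h.conj_of_mem_im hx)).trans (neg_mul_neg _ _)
  have e1 : b (associator x y z) w = b (associator y x w) z := by
    simp only [associator, map_sub, LinearMap.sub_apply]
    rw [h.mul_left, e, h.form_mul_left hx, h.form_mul_left hy, neg_neg, h.symm z, h.symm z]
  rw [e1, h.associator_swap_left hy hx, map_neg, LinearMap.neg_apply]

/-- A triple of imaginary elements with vanishing associator spans an associative subspace. -/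
theorem isAssociativeSubspace_span_triple {x y z : O} (hx : x ∈ σ.im) (hy : y ∈ σ.im)
    (hz : z ∈ σ.im) (h0 : associator x y z = 0) : IsAssociativeSubspace (span F {x, y, z}) := by
  have h1 : associator y x z = 0 := by rw [h.associator_swap_left hy hx, h0, neg_zero]
  have h2 : associator x z y = 0 := by rw [h.associator_swap_right hz hy, h0, neg_zero]
  have h3 : associator y z x = 0 := by rw [h.associator_swap_right hz hx, h1, neg_zero]
  have h4 : associator z x y = 0 := by rw [h.associator_swap_left hz hx, h2, neg_zero]
  have h5 : associator z y x = 0 := by rw [h.associator_swap_left hz hy, h3, neg_zero]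
  apply isAssociativeSubspace_span
  rintro u (rfl | rfl | rfl) v (rfl | rfl | rfl) w (rfl | rfl | rfl) <;>
  first
  | assumption
  | exact h.associator_self_left ‹_› _
  | exact h.associator_self_right ‹_› _
  | exact h.associator_self_mid ‹_› ‹_›

/-- A subspace containing `1` is associative if its imaginary elements associate. -/
theorem isAssociativeSubspace_of_im {W : Submodule F O} (h1 : (1 : O) ∈ W)
    (hW : ∀ x ∈ W ⊓ σ.im, ∀ y ∈ W ⊓ σ.im, ∀ z ∈ W ⊓ σ.im, associator x y z = 0) :
    IsAssociativeSubspace W := by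
  rw [isAssociativeSubspace_iff]
  intro x hx y hy z hz
  obtain ⟨r, x, hx', rfl⟩ := h.exists_im x
  obtain ⟨s, y, hy', rfl⟩ := h.exists_im y
  obtain ⟨t, z, hz', rfl⟩ := h.exists_im z
  rw [add_mem_cancel_left (W.smul_mem _ h1)] at hx hy hz
  rw [associator_add_left, associator_smul_one_left, zero_add, associator_add_mid,
    associator_smul_one_mid, zero_add, associator_add_right, associator_smul_one_right, zero_add,
    hW x ⟨hx, hx'⟩ y ⟨hy, hy'⟩ z ⟨hz, hz'⟩]

/-- A subspace containing `1` is a subalgebra if it contains the products of its imaginary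
elements. -/
theorem isSubalgebra_of_im {W : Submodule F O} (h1 : (1 : O) ∈ W)
    (hW : ∀ x ∈ W ⊓ σ.im, ∀ y ∈ W ⊓ σ.im, x * y ∈ W) : IsSubalgebra W := by
  refine ⟨h1, fun x hx y hy => ?_⟩
  obtain ⟨r, x, hx', rfl⟩ := h.exists_im x
  rw [add_mul, smul_mul_assoc, one_mul]
  refine add_mem (W.smul_mem _ hy) ?_
  rw [add_mem_cancel_left (W.smul_mem _ h1)] at hx
  obtain ⟨s, y, hy', rfl⟩ := h.exists_im y
  rw [mul_add, mul_smul_comm, mul_one]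
  rw [add_mem_cancel_left (W.smul_mem _ h1)] at hy
  exact add_mem (W.smul_mem _ hx) (hW x ⟨hx, hx'⟩ y ⟨hy, hy'⟩)

end IsCayleyForm
end CayleyDickson

/-! ### Orthogonality, and four-dimensional subalgebras versus associative subspaces -/

namespace CayleyDickson

open Module Submodule

namespace IsCayleyForm

variable {F : Type*} [Field F] [NeZero (2 : F)] {O : Type*} [NonAssocRing O] [Module F O]
  {σ : StrongInvolution F O} {b : LinearMap.BilinForm F O} (h : IsCayleyForm σ b)

include h

theorem isRefl : b.IsRefl := fun x y hxy => by rw [h.symm, hxy]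

theorem nondegenerate : b.Nondegenerate :=
  ⟨h.nondeg, fun x hx => h.nondeg x fun y => by rw [h.symm, hx]⟩

theorem orthogonal_orthogonal (W : Submodule F O) : b.orthogonal (b.orthogonal W) = W :=
  have := h.finiteDimensional
  LinearMap.BilinForm.orthogonal_orthogonal h.nondegenerate h.isRefl W

theorem finrank_orthogonal (W : Submodule F O) : finrank F (b.orthogonal W) = 8 - finrank F W := by
  have := h.finiteDimensional
  rw [LinearMap.BilinForm.finrank_orthogonal h.nondegenerate, h.finrank_eq]

theorem im_eq : σ.im = b.orthogonal (span F {1}) := by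
  ext x
  rw [h.mem_im, LinearMap.BilinForm.mem_orthogonal_iff]
  constructor
  · intro hx y hy
    obtain ⟨r, rfl⟩ := mem_span_singleton.1 hy
    simp [h.symm 1 x, hx]
  · intro hx
    rw [h.symm]
    exact hx 1 (mem_span_singleton_self _)

theorem finrank_im : finrank F σ.im = 7 := by
  rw [h.im_eq, h.finrank_orthogonal, finrank_span_singleton h.one_ne_zero]

/-- A vector outside a subspace is detected by a vector orthogonal to the subspace. -/
theorem exists_orthogonal {W : Submodule F O} {v : O} (hv : v ∉ W) :
    ∃ a, (∀ w ∈ W, b w a = 0) ∧ b v a ≠ 0 := by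
  by_contra! hc
  refine hv ?_
  rw [← h.orthogonal_orthogonal W]
  intro a ha
  rw [h.symm]
  exact hc a ha

/-- If `1 ∈ W` and `dim W ≤ 4`, then `W` is orthogonal to an anisotropic vector. -/
theorem exists_anisotropic {W : Submodule F O} (h1 : (1 : O) ∈ W) (hW : finrank F W ≤ 4) :
    ∃ n, (∀ w ∈ W, b w n = 0) ∧ b n n ≠ 0 := by
  by_contra! hc
  have := h.finiteDimensional
  -- If the quadratic form vanishes on the orthogonal space of `W`, so does `b` by polarisation, and
  -- the orthogonal space lies in its own orthogonal space, namely `W`. Equality by dimension would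
  -- then make `1` isotropic.
  have hle : b.orthogonal W ≤ W := by
    conv_rhs => rw [← h.orthogonal_orthogonal W]
    intro x hx y hy
    have hxy := hc (x + y) (add_mem hx hy)
    simp only [map_add, LinearMap.add_apply, hc x hx, hc y hy, h.symm y x] at hxy
    rw [h.symm]
    have h2 : (2 : F) ≠ 0 := NeZero.ne _
    have : 2 * b x y = 0 := by linear_combination hxy
    exact (mul_eq_zero.1 this).resolve_left h2
  have heq : b.orthogonal W = W :=
    eq_of_le_of_finrank_le hle (by rw [h.finrank_orthogonal]; omega)
  have h11 : b 1 1 = 0 := (heq.symm.le h1 : (1 : O) ∈ b.orthogonal W) 1 h1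
  exact _root_.one_ne_zero (h.one_one.symm.trans h11)

theorem mul_ne_zero_of_anisotropic {x n : O} (hx : x ≠ 0) (hn : b n n ≠ 0) : x * n ≠ 0 := by
  intro h0
  have := h.mul_mul_conj n x
  rw [h0, zero_mul, eq_comm, smul_eq_zero] at this
  tauto

theorem finrank_inf_im {W : Submodule F O} (h1 : (1 : O) ∈ W) :
    finrank F (W ⊓ σ.im : Submodule F O) + 1 = finrank F W := by
  have := h.finiteDimensional
  rw [← finrank_sup_span_singleton fun h' : (1 : O) ∈ W ⊓ σ.im => h.one_notMem_im h'.2]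
  suffices hs : W ⊓ σ.im ⊔ span F {(1 : O)} = W by rw [hs]
  apply le_antisymm
  · exact sup_le inf_le_left ((span_singleton_le_iff_mem _ _).2 h1)
  · intro x hx
    obtain ⟨r, y, hy, rfl⟩ := h.exists_im x
    rw [add_mem_cancel_left (W.smul_mem _ h1)] at hx
    exact add_mem (mem_sup_right (smul_mem _ _ (mem_span_singleton_self _)))
      (mem_sup_left ⟨hx, hy⟩)

theorem finrank_scalars_sup {A : Submodule F O} (h1 : (1 : O) ∉ A) :
    finrank F (scalars F O ⊔ A : Submodule F O) = finrank F A + 1 := by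
  have := h.finiteDimensional
  rw [sup_comm, scalars, finrank_sup_span_singleton h1]

theorem scalars_sup_inf_im {A : Submodule F O} (hA : A ≤ σ.im) :
    (scalars F O ⊔ A) ⊓ σ.im = A := by
  rw [sup_comm, sup_inf_assoc_of_le _ hA, sup_eq_left.2]
  rintro x ⟨hx, hx'⟩
  obtain ⟨r, rfl⟩ := mem_span_singleton.1 hx
  have : r = 0 := by simpa [h.mem_im, h.one_one] using hx'
  simp [this]

variable [SMulCommClass F O O] [IsScalarTower F O O]

theorem isAssociativeSubspace_scalars_sup {A : Submodule F O} (hA : IsAssociativeSubspace A) :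
    IsAssociativeSubspace (scalars F O ⊔ A) := by
  rw [isAssociativeSubspace_iff] at hA ⊢
  intro x hx y hy z hz
  obtain ⟨x', hx', x, hxA, rfl⟩ := mem_sup.1 hx
  obtain ⟨y', hy', y, hyA, rfl⟩ := mem_sup.1 hy
  obtain ⟨z', hz', z, hzA, rfl⟩ := mem_sup.1 hz
  obtain ⟨r, rfl⟩ := mem_span_singleton.1 hx'
  obtain ⟨s, rfl⟩ := mem_span_singleton.1 hy'
  obtain ⟨t, rfl⟩ := mem_span_singleton.1 hz'
  rw [associator_add_left, associator_smul_one_left, zero_add, associator_add_mid,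
    associator_smul_one_mid, zero_add, associator_add_right, associator_smul_one_right, zero_add,
    hA x hxA y hyA z hzA]

/-- Once the associator vanishes, `associator_mul` becomes a linear relation between `x, y, z` and
the imaginary parts `yz + b(y, z) 1` and so on. A suitable choice of `a` isolates single terms. -/
theorem sum_eq_of_associator_eq_zero {x y z a : O} (hx : x ∈ σ.im) (hy : y ∈ σ.im)
    (hz : z ∈ σ.im) (ha : a ∈ σ.im) (h0 : associator x y z = 0) :
    b (y * z) a • x + b (z * x) a • y + b (x * y) a • z =
      b x a • (y * z + b y z • (1 : O)) + b y a • (z * x + b z x • (1 : O)) +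
        b z a • (x * y + b x y • (1 : O)) := by
  have := h.associator_mul x y z a (h.mem_im.1 hx) (h.mem_im.1 hy) (h.mem_im.1 hz) (h.mem_im.1 ha)
  rw [h0, zero_mul, map_zero, LinearMap.zero_apply, zero_smul, add_zero, eq_comm,
    smul_eq_zero] at this
  exact sub_eq_zero.1 (this.resolve_left (NeZero.ne _))

/-- A four-dimensional associative subspace containing `1` is a subalgebra. -/
theorem isSubalgebra_of_isAssociativeSubspace {W : Submodule F O} (h1 : (1 : O) ∈ W)
    (hW : finrank F W = 4) (hA : IsAssociativeSubspace W) : IsSubalgebra W := by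
  have := h.finiteDimensional
  rw [isAssociativeSubspace_iff] at hA
  refine h.isSubalgebra_of_im h1 fun y hy z hz => ?_
  by_contra hyz
  obtain ⟨a, haW, hne⟩ := h.exists_orthogonal hyz
  have ha : a ∈ σ.im := h.mem_im.2 (by rw [h.symm, haW 1 h1])
  -- As `a` is orthogonal to `W`, the relation leaves `x` with the nonzero coefficient `b(yz, a)`
  -- against multiples of `y` and `z` only.
  have hle : W ≤ span F {1, y, z} := by
    intro x hx
    obtain ⟨r, x, hx', rfl⟩ := h.exists_im x
    rw [add_mem_cancel_left (W.smul_mem _ h1)] at hx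
    have key := h.sum_eq_of_associator_eq_zero hx' hy.2 hz.2 ha (hA x hx y hy.1 z hz.1)
    rw [haW x hx, haW y hy.1, haW z hz.1, zero_smul, zero_smul, zero_smul, add_zero, add_zero]
      at key
    refine add_mem (smul_mem _ _ (subset_span (by simp))) ?_
    rw [← smul_mem_iff _ hne]
    have : b (y * z) a • x = (-b (z * x) a) • y + (-b (x * y) a) • z := by
      linear_combination (norm := module) key
    rw [this]
    exact add_mem (smul_mem _ _ (subset_span (by simp))) (smul_mem _ _ (subset_span (by simp)))
  have h4 := finrank_mono hle
  have h3 : finrank F (span F ({1, y, z} : Set O)) ≤ 3 := by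
    classical
    refine (finrank_span_le_card _).trans ?_
    rw [Set.toFinset_insert, Set.toFinset_insert, Set.toFinset_singleton]
    exact Finset.card_le_three
  omega

/-- A four-dimensional subalgebra is associative. -/
theorem isAssociativeSubspace_of_isSubalgebra {W : Submodule F O} (hW : finrank F W = 4)
    (hS : IsSubalgebra W) : IsAssociativeSubspace W := by
  refine h.isAssociativeSubspace_of_im hS.1 fun x hx y hy z hz => ?_
  by_contra ht
  -- All products occurring in `associator_mul` lie in `W`, so pairing with `n` kills everything
  -- except `[x, y, z] n`.
  obtain ⟨n, hnW, hn⟩ := h.exists_anisotropic hS.1 hW.le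
  have hn' : n ∈ σ.im := h.mem_im.2 (by rw [h.symm, hnW 1 hS.1])
  have key := h.associator_mul x y z n (h.mem_im.1 hx.2) (h.mem_im.1 hy.2) (h.mem_im.1 hz.2)
    (h.mem_im.1 hn')
  have htW : associator x y z ∈ W :=
    sub_mem (hS.2 _ (hS.2 _ hx.1 _ hy.1) _ hz.1) (hS.2 _ hx.1 _ (hS.2 _ hy.1 _ hz.1))
  rw [hnW _ htW, hnW _ hx.1, hnW _ hy.1, hnW _ hz.1, hnW _ (hS.2 _ hx.1 _ hy.1),
    hnW _ (hS.2 _ hy.1 _ hz.1), hnW _ (hS.2 _ hz.1 _ hx.1)] at key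
  exact h.mul_ne_zero_of_anisotropic ht hn (by simpa using key)

/-- A three-dimensional associative subspace without `1` spans a subalgebra together
with `1`. -/
theorem isSubalgebra_scalars_sup {A : Submodule F O} (h3 : finrank F A = 3)
    (hA : IsAssociativeSubspace A) (h1 : (1 : O) ∉ A) : IsSubalgebra (scalars F O ⊔ A) :=
  h.isSubalgebra_of_isAssociativeSubspace (mem_sup_left (mem_span_singleton_self _))
    (by rw [h.finrank_scalars_sup h1, h3]) (isAssociativeSubspace_scalars_sup h hA)

/-- The imaginary parts of the four-dimensional subalgebras are the three-dimensional associative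
spaces of imaginary elements. -/
theorem subalgebraBlocks_eq : subalgebraBlocks σ = associativeBlocks σ := by
  ext B
  constructor
  · rintro ⟨H, hH, h4, rfl⟩
    refine ⟨inf_le_right, ?_, ?_⟩
    · have := h.finrank_inf_im hH.1
      rw [StrongInvolution.imOf]; omega
    · have := h.isAssociativeSubspace_of_isSubalgebra h4 hH
      exact fun x hx y hy z hz => this x hx.1 y hy.1 z hz.1
  · rintro ⟨hB, h3, hA⟩
    have h1 : (1 : O) ∉ B := fun h1 => h.one_notMem_im (hB h1)
    exact ⟨scalars F O ⊔ B, h.isSubalgebra_scalars_sup h3 hA h1,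
      by rw [h.finrank_scalars_sup h1, h3], (h.scalars_sup_inf_im hB).symm⟩

end IsCayleyForm
end CayleyDickson

/-! ### Every block contains a pair whose product is new -/

namespace CayleyDickson

open Module Submodule

theorem eq_zero_of_smul_add_smul_add_smul {F V : Type*} [Field F] [AddCommGroup V] [Module F V]
    {x y z : V} (hx : x ≠ 0) (hy : y ∉ span F {x}) (hz : z ∉ span F {x, y}) (p q r : F)
    (h0 : p • x + q • y + r • z = 0) : p = 0 ∧ q = 0 ∧ r = 0 := by
  have hr : r = 0 := by
    by_contra hr
    refine hz ((smul_mem_iff _ hr).1 ?_)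
    rw [show r • z = (-p) • x + (-q) • y by linear_combination (norm := module) h0]
    exact mem_span_pair.2 ⟨_, _, rfl⟩
  subst hr
  have hq : q = 0 := by
    by_contra hq
    refine hy ((smul_mem_iff _ hq).1 ?_)
    rw [show q • y = (-p) • x by linear_combination (norm := module) h0]
    exact mem_span_singleton.2 ⟨_, rfl⟩
  subst hq
  simpa [hx] using h0

theorem exists_mem_notMem_span_pair {F V : Type*} [Field F] [AddCommGroup V] [Module F V]
    {B : Submodule F V} (hB : 3 ≤ finrank F B) (x y : V) : ∃ z ∈ B, z ∉ span F {x, y} := by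
  by_contra! hc
  have := FiniteDimensional.span_of_finite F (Set.toFinite ({x, y} : Set V))
  have h1 : finrank F B ≤ finrank F (span F ({x, y} : Set V)) := finrank_mono hc
  classical
  have h2 := finrank_span_le_card (R := F) ({x, y} : Set V)
  rw [Set.toFinset_insert, Set.toFinset_singleton] at h2
  have := h2.trans Finset.card_le_two
  omega

theorem exists_mem_notMem_span_singleton {F V : Type*} [Field F] [AddCommGroup V] [Module F V]
    {B : Submodule F V} (hB : 2 ≤ finrank F B) (x : V) : ∃ z ∈ B, z ∉ span F {x} := by
  by_contra! hc
  have h1 : finrank F B ≤ finrank F (span F ({x} : Set V)) := finrank_mono hc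
  have h2 := finrank_span_le_card (R := F) ({x} : Set V)
  rw [Set.toFinset_singleton, Finset.card_singleton] at h2
  omega

namespace IsCayleyForm

variable {F : Type*} [Field F] [NeZero (2 : F)] {O : Type*} [NonAssocRing O] [Module F O]
  {σ : StrongInvolution F O} {b : LinearMap.BilinForm F O} (h : IsCayleyForm σ b)

include h

theorem mem_span_one_insert {S : Set O} (hS : S ⊆ σ.im) {x : O} (hx : x ∈ σ.im) :
    x ∈ span F (insert 1 S) ↔ x ∈ span F S := by
  refine ⟨fun hm => ?_, fun hm => span_mono (Set.subset_insert _ _) hm⟩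
  obtain ⟨r, y, hy, rfl⟩ := mem_span_insert.1 hm
  have hy' : y ∈ σ.im := span_le.2 hS hy
  have : r = 0 := by
    have := (add_mem_cancel_right hy').1 hx
    simpa [h.mem_im, h.one_one] using this
  simpa [this] using hy

/-- Adjoining `1` to `S` forces the separating vector to be imaginary, as `associator_mul` requires.
-/
theorem exists_im_orthogonal {S : Set O} (hS : S ⊆ σ.im) {x : O} (hx : x ∈ σ.im)
    (hxS : x ∉ span F S) : ∃ a ∈ σ.im, (∀ w ∈ S, b w a = 0) ∧ b x a ≠ 0 := by
  rw [← h.mem_span_one_insert hS hx] at hxS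
  obtain ⟨a, ha, hne⟩ := h.exists_orthogonal hxS
  exact ⟨a, h.mem_im.2 (by rw [h.symm, ha 1 (subset_span (by simp))]),
    fun w hw => ha w (subset_span (by simp [hw])), hne⟩

theorem exists_mul_add_eq {x y : O} (hx : x ∈ σ.im) (hy : y ∈ σ.im)
    (hxy : x * y ∈ span F {1, x, y}) :
    ∃ p q : F, x * y + b x y • (1 : O) = p • x + q • y := by
  have him : x * y + b x y • (1 : O) ∈ σ.im := by
    rw [h.mem_im, map_add, LinearMap.add_apply, h.form_mul_one hx]; simp [h.one_one]
  have hm := (h.mem_span_one_insert (S := {x, y}) (by rintro _ (rfl | rfl) <;> assumption) him).1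
    (add_mem hxy (smul_mem _ _ (subset_span (by simp))))
  obtain ⟨p, q, hpq⟩ := mem_span_pair.1 hm
  exact ⟨p, q, hpq.symm⟩

variable [SMulCommClass F O O] [IsScalarTower F O O]

/-- Let `u` be the `z`-coefficient of the imaginary part of `zx`. Additivity, comparing `x(y + z)`
with `xy + xz`, gives `q = -u`; associativity gives `q = u`. Hence `2q = 0`. -/
theorem coeff_eq_zero_of_mul_mem_span {x y z : O} (hx : x ∈ σ.im) (hy : y ∈ σ.im) (hz : z ∈ σ.im)
    (hli : ∀ p q r : F, p • x + q • y + r • z = 0 → p = 0 ∧ q = 0 ∧ r = 0)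
    (h0 : associator x y z = 0)
    (hyz : y * z ∈ span F {1, y, z}) (hzx : z * x ∈ span F {1, z, x})
    (hxs : x * (y + z) ∈ span F {1, x, y + z}) {p q : F}
    (hxy : x * y + b x y • (1 : O) = p • x + q • y) : q = 0 := by
  obtain ⟨r, s, hyz⟩ := h.exists_mul_add_eq hy hz hyz
  obtain ⟨u, v, hzx⟩ := h.exists_mul_add_eq hz hx hzx
  obtain ⟨c, d, hxs⟩ := h.exists_mul_add_eq hx (add_mem hy hz) hxs
  have hxz := h.mul_add_mul hx hz
  have e1 := hli (p - v - c) (q - d) (-u - d) (by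
    rw [mul_add, map_add] at hxs
    rw [h.symm z x] at hzx
    linear_combination (norm := module) hxs - hxy + hzx - hxz)
  have hyn : y ∉ span F {x, z} := by
    intro hm
    obtain ⟨m, n, hmn⟩ := mem_span_pair.1 hm
    have := (hli m (-1) n (by rw [← hmn]; module)).2.1
    simp at this
  -- Pairing with `a` reads off the `y`-coefficient.
  obtain ⟨a, ha, hS, hne⟩ := h.exists_im_orthogonal (S := {x, z})
    (by rintro _ (rfl | rfl) <;> assumption) hy hyn
  have hxa := hS x (by simp)
  have hza := hS z (by simp)
  have h1a : b 1 a = 0 := by rw [h.symm, h.mem_im.1 ha]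
  have key := h.sum_eq_of_associator_eq_zero hx hy hz ha h0
  have f1 : b (y * z) a = r * b y a := by
    have := congrArg (fun w => b w a) hyz
    simpa [h1a, hza] using this
  have f2 : b (z * x) a = 0 := by
    have := congrArg (fun w => b w a) hzx
    simpa [h1a, hza, hxa] using this
  have f3 : b (x * y) a = q * b y a := by
    have := congrArg (fun w => b w a) hxy
    simpa [h1a, hxa] using this
  rw [f1, f2, f3, hxa, hza, hzx] at key
  have e2 := hli (r * b y a - b y a * v) 0 (q * b y a - b y a * u) (by
    linear_combination (norm := module) key)
  have e3 : q = u := mul_right_cancel₀ hne (by linear_combination e2.2.2)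
  have h2 : (2 : F) ≠ 0 := NeZero.ne _
  have : 2 * q = 0 := by linear_combination e1.2.1 - e1.2.2 + e3
  exact (mul_eq_zero.1 this).resolve_left h2

/-- A three-dimensional associative space of imaginary elements in which `x y` always lies in the
span of `1, x, y` has zero multiplication. -/
theorem mul_eq_zero_of_mul_mem_span {B : Submodule F O} (hB : B ∈ associativeBlocks σ)
    (hm : ∀ x ∈ B, ∀ y ∈ B, x * y ∈ span F {1, x, y}) : ∀ x ∈ B, ∀ y ∈ B, x * y = 0 ∧ b x y = 0 := by
  obtain ⟨hBi, h3, hA⟩ := hB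
  rw [isAssociativeSubspace_iff] at hA
  have key : ∀ x ∈ B, ∀ y ∈ B, x ≠ 0 → y ∉ span F {x} →
      x * y = 0 ∧ b x y = 0 ∧ b x x = 0 := by
    intro x hx y hy hx0 hyx
    obtain ⟨z, hz, hzxy⟩ := exists_mem_notMem_span_pair h3.ge x y
    have hli := eq_zero_of_smul_add_smul_add_smul hx0 hyx hzxy
    obtain ⟨p, q, hpq⟩ := h.exists_mul_add_eq (hBi hx) (hBi hy) (hm x hx y hy)
    have hq : q = 0 := h.coeff_eq_zero_of_mul_mem_span (hBi hx) (hBi hy) (hBi hz) hli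
      (hA x hx y hy z hz) (hm y hy z hz) (hm z hz x hx) (hm x hx _ (add_mem hy hz)) hpq
    -- Imaginary parts of products are skew, so `yx` has coefficients `-q` at `y` and `-p` at `x`;
    -- the same lemma with `x, y` interchanged applies.
    have hp : -p = 0 := h.coeff_eq_zero_of_mul_mem_span (hBi hy) (hBi hx) (hBi hz)
      (fun p q r h0 => by
        have := hli q p r (by rw [← h0]; abel)
        tauto)
      (hA y hy x hx z hz) (hm x hx z hz) (hm z hz y hy) (hm y hy _ (add_mem hx hz))
      (p := -q) (by
        rw [h.symm y x]
        linear_combination (norm := module) h.mul_add_mul (hBi hx) (hBi hy) - hpq)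
    have hxy : x * y = -(b x y • (1 : O)) := by
      rw [neg_eq_zero.1 hp, hq, zero_smul, zero_smul, add_zero] at hpq
      exact eq_neg_of_add_eq_zero_left hpq
    -- With `xy` scalar, `x(xy) = -b(x, x) y` becomes a relation between the independent vectors `x`
    -- and `y`.
    have h1 := h.mul_mul_left (hBi hx) y
    rw [hxy, mul_neg, mul_smul_comm, mul_one] at h1
    have h2 := hli (b x y) (-b x x) 0 (by linear_combination (norm := module) -h1)
    exact ⟨by rw [hxy, h2.1, zero_smul, neg_zero], h2.1, neg_eq_zero.1 h2.2.1⟩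
  have key2 : ∀ x ∈ B, b x x = 0 := by
    intro x hx
    by_cases hx0 : x = 0
    · simp [hx0]
    · obtain ⟨y, hy, hyx⟩ := exists_mem_notMem_span_singleton (by omega : 2 ≤ finrank F B) x
      exact (key x hx y hy hx0 hyx).2.2
  intro x hx y hy
  by_cases hx0 : x = 0
  · simp [hx0]
  by_cases hyx : y ∈ span F {x}
  · obtain ⟨r, rfl⟩ := mem_span_singleton.1 hyx
    rw [mul_smul_comm, h.mul_self (hBi hx), map_smul, key2 x hx]
    simp
  · have := key x hx y hy hx0 hyx
    exact ⟨this.1, this.2.1⟩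

/-- A three-dimensional space of imaginary elements does not have zero multiplication. -/
theorem not_mul_eq_zero {B : Submodule F O} (hBi : B ≤ σ.im) (h3 : finrank F B = 3)
    (h0 : ∀ x ∈ B, ∀ y ∈ B, x * y = 0 ∧ b x y = 0) : False := by
  have := h.finiteDimensional
  have h1B : (1 : O) ∉ B := fun h1 => h.one_notMem_im (hBi h1)
  have h1W : (1 : O) ∈ scalars F O ⊔ B := mem_sup_left (mem_span_singleton_self _)
  have h4 : finrank F (scalars F O ⊔ B : Submodule F O) = 4 := by
    rw [h.finrank_scalars_sup h1B, h3]
  obtain ⟨n, hnW, hn⟩ := h.exists_anisotropic h1W h4.le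
  have hBn : ∀ x ∈ B, b x n = 0 := fun x hx => hnW x (mem_sup_right hx)
  have hni : n ∈ σ.im := h.mem_im.2 (by rw [h.symm, hnW 1 h1W])
  have hnB : n ∉ B := fun hnB => hn (hBn n hnB)
  have horth : ∀ w : O, b 1 w = 0 → (∀ x ∈ B, b x w = 0) → w ∈ b.orthogonal (scalars F O ⊔ B) := by
    intro w h1 hw u hu
    obtain ⟨u', hu', x, hx, rfl⟩ := mem_sup.1 hu
    obtain ⟨r, rfl⟩ := mem_span_singleton.1 hu'
    simp [h1, hw x hx]
  -- Both sides have dimension four, since `B` is totally isotropic and orthogonal to `1`.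
  have heq : B ⊔ span F {n} = b.orthogonal (scalars F O ⊔ B) := by
    apply eq_of_le_of_finrank_eq
    · refine sup_le (fun x hx => horth x ?_ fun y hy => (h0 y hy x hx).2)
        ((span_singleton_le_iff_mem _ _).2 (horth n (hnW 1 h1W) hBn))
      rw [h.symm, h.mem_im.1 (hBi hx)]
    · rw [h.finrank_orthogonal, h4, finrank_sup_span_singleton hnB, h3]
  -- The product `xn` is orthogonal to `1` and `B`, so it lies in `B + Fn`; as `b(xn, n) = 0`, its
  -- `n`-component vanishes.
  have hmul : ∀ x ∈ B, x * n ∈ B := by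
    intro x hx
    have hm : x * n ∈ B ⊔ span F {n} := by
      rw [heq]
      refine horth _ ?_ fun y hy => ?_
      · rw [h.symm, h.form_mul_one (hBi hx), hBn x hx, neg_zero]
      · rw [h.symm, h.form_mul_left (hBi hx), (h0 x hx y hy).1, map_zero, neg_zero]
    obtain ⟨y, hy, z, hz, hyz⟩ := mem_sup.1 hm
    obtain ⟨r, rfl⟩ := mem_span_singleton.1 hz
    have h1 := h.form_mul_self_right (hBi hx) hni
    rw [← hyz, map_add, LinearMap.add_apply, hBn y hy, map_smul, LinearMap.smul_apply, smul_eq_mul,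
      zero_add] at h1
    rw [← hyz, (mul_eq_zero.1 h1).resolve_right hn, zero_smul, add_zero]
    exact hy
  have hid : ∀ x ∈ B, ∀ y ∈ B, ∀ a ∈ σ.im, b (y * n) a • x - b (x * n) a • y =
      b x a • (y * n) - b y a • (x * n) := by
    intro x hx y hy a ha
    have ht : associator x y n = 0 := by
      rw [associator, (h0 x hx y hy).1, (h0 x hx _ (hmul y hy)).1, zero_mul, sub_zero]
    have key := h.sum_eq_of_associator_eq_zero (hBi hx) (hBi hy) hni ha ht
    have hnx : n * x = -(x * n) := by
      have := h.mul_add_mul hni (hBi hx)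
      rw [h.symm n x, hBn x hx, mul_zero, zero_smul, neg_zero] at this
      exact eq_neg_of_add_eq_zero_left this
    rw [hnx, (h0 x hx y hy).1, (h0 x hx y hy).2, h.symm n x, hBn x hx, hBn y hy, map_neg, map_zero,
      LinearMap.neg_apply, LinearMap.zero_apply] at key
    linear_combination (norm := module) key
  -- Otherwise an `a` orthogonal to `x` but not to `xn` puts every `y` of `B` into `span {x, xn}`,
  -- which is too small.
  have hline : ∀ x ∈ B, x * n ∈ span F {x} := by
    intro x hx
    by_contra hxn
    obtain ⟨y, hy, hyx⟩ := exists_mem_notMem_span_pair h3.ge x (x * n)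
    obtain ⟨a, ha, hS, hne⟩ := h.exists_im_orthogonal (S := {x})
      (by rintro _ rfl; exact hBi hx) (hBi (hmul x hx)) hxn
    have key := hid x hx y hy a ha
    rw [hS x rfl] at key
    refine hyx ((smul_mem_iff _ hne).1 (mem_span_pair.2 ⟨b (y * n) a, b y a, ?_⟩))
    linear_combination (norm := module) key
  -- For eigenvectors, `hid` reads `(p + q)(b(y, a) x - b(x, a) y) = 0`. With three independent
  -- vectors the pairwise sums of eigenvalues vanish, so the eigenvalues vanish, although right
  -- multiplication by `n` is injective.
  have hsum : ∀ x ∈ B, ∀ y ∈ B, x ≠ 0 → y ∉ span F {x} → ∀ p q : F, p • x = x * n →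
      q • y = y * n → p + q = 0 := by
    intro x hx y hy hx0 hyx p q hp hq
    obtain ⟨a, ha, -, hne⟩ := h.exists_im_orthogonal (S := ∅) (by simp) (hBi hx) (by simpa)
    have key := hid x hx y hy a ha
    rw [← hp, ← hq] at key
    simp only [map_smul, LinearMap.smul_apply, smul_eq_mul] at key
    by_contra hpq
    refine hyx ((smul_mem_iff _ (mul_ne_zero hpq hne)).1
      (mem_span_singleton.2 ⟨(p + q) * b y a, ?_⟩))
    linear_combination (norm := module) key
  obtain ⟨x, hx, hx0⟩ : ∃ x ∈ B, x ≠ 0 := by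
    obtain ⟨x, hx, hx0⟩ := exists_mem_notMem_span_singleton (by omega : 2 ≤ finrank F B) (0 : O)
    exact ⟨x, hx, fun e => hx0 (by simp [e])⟩
  obtain ⟨y, hy, hyx⟩ := exists_mem_notMem_span_singleton (by omega : 2 ≤ finrank F B) x
  obtain ⟨z, hz, hzxy⟩ := exists_mem_notMem_span_pair h3.ge x y
  have hy0 : y ≠ 0 := fun e => hyx (by simp [e])
  have hzx : z ∉ span F {x} := fun hm => hzxy (span_mono (by simp) hm)
  have hzy : z ∉ span F {y} := fun hm => hzxy (span_mono (by simp) hm)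
  obtain ⟨p, hp⟩ := mem_span_singleton.1 (hline x hx)
  obtain ⟨q, hq⟩ := mem_span_singleton.1 (hline y hy)
  obtain ⟨r, hr⟩ := mem_span_singleton.1 (hline z hz)
  have e1 := hsum x hx y hy hx0 hyx p q hp hq
  have e2 := hsum x hx z hz hx0 hzx p r hp hr
  have e3 := hsum y hy z hz hy0 hzy q r hq hr
  have h2 : (2 : F) ≠ 0 := NeZero.ne _
  have h2p : 2 * p = 0 := by linear_combination e1 + e2 - e3
  rw [(mul_eq_zero.1 h2p).resolve_left h2, zero_smul] at hp
  exact h.mul_ne_zero_of_anisotropic hx0 hn hp.symm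

/-- Every three-dimensional associative space of imaginary elements contains `x, y` such that
`x y` is not in the span of `1, x, y`. -/
theorem exists_mul_notMem_span {B : Submodule F O} (hB : B ∈ associativeBlocks σ) :
    ∃ x ∈ B, ∃ y ∈ B, x * y ∉ span F {1, x, y} := by
  by_contra! hm
  exact h.not_mul_eq_zero hB.1 hB.2.1 (h.mul_eq_zero_of_mul_mem_span hB hm)

end IsCayleyForm
end CayleyDickson

/-! ### Covering of planes and local minimality -/

namespace CayleyDickson

open Module Submodule

/-- A skew-symmetric matrix of odd size over a field of characteristic not two is singular. -/
theorem det_eq_zero_of_transpose_eq_neg {F : Type*} [Field F] [NeZero (2 : F)] {n : ℕ}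
    (hn : Odd n) (M : Matrix (Fin n) (Fin n) F) (hM : M.transpose = -M) : M.det = 0 := by
  have h1 := M.det_transpose
  rw [hM, Matrix.det_neg, Fintype.card_fin, hn.neg_one_pow] at h1
  have h2 : (2 : F) * M.det = 0 := by linear_combination -h1
  exact (mul_eq_zero.1 h2).resolve_left (NeZero.ne _)

theorem finrank_span_insert {F V : Type*} [Field F] [AddCommGroup V] [Module F V]
    [FiniteDimensional F V] {v : V} {S : Set V} (hv : v ∉ span F S) :
    finrank F (span F (insert v S)) = finrank F (span F S) + 1 := by
  rw [span_insert, sup_comm, finrank_sup_span_singleton hv]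

theorem finrank_span_pair {F V : Type*} [Field F] [AddCommGroup V] [Module F V]
    [FiniteDimensional F V] {x y : V} (hx : x ≠ 0) (hy : y ∉ span F {x}) :
    finrank F (span F ({x, y} : Set V)) = 2 := by
  rw [Set.pair_comm, finrank_span_insert hy, finrank_span_singleton hx]

theorem finrank_span_triple {F V : Type*} [Field F] [AddCommGroup V] [Module F V]
    [FiniteDimensional F V] {x y z : V} (hx : x ≠ 0) (hy : y ∉ span F {x})
    (hz : z ∉ span F {x, y}) : finrank F (span F ({x, y, z} : Set V)) = 3 := by
  rw [show ({x, y, z} : Set V) = {z, x, y} by ext; simp; tauto, finrank_span_insert hz,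
    finrank_span_pair hx hy]

theorem exists_eq_span_pair {F V : Type*} [Field F] [AddCommGroup V] [Module F V]
    [FiniteDimensional F V] {T : Submodule F V} (hT : finrank F T = 2) :
    ∃ x ∈ T, ∃ y ∈ T, x ≠ 0 ∧ y ∉ span F {x} ∧ T = span F {x, y} := by
  obtain ⟨x, hx, hx0⟩ := exists_mem_notMem_span_singleton hT.ge (0 : V)
  obtain ⟨y, hy, hyx⟩ := exists_mem_notMem_span_singleton hT.ge x
  have hx0 : x ≠ 0 := fun e => hx0 (by simp [e])
  refine ⟨x, hx, y, hy, hx0, hyx, (eq_of_le_of_finrank_eq ?_ ?_).symm⟩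
  · rw [span_le]; rintro _ (rfl | rfl) <;> assumption
  · rw [finrank_span_pair hx0 hyx, hT]

namespace IsCayleyForm

variable {F : Type*} [Field F] [NeZero (2 : F)] {O : Type*} [NonAssocRing O] [Module F O]
  {σ : StrongInvolution F O} {b : LinearMap.BilinForm F O} (h : IsCayleyForm σ b)
  [SMulCommClass F O O] [IsScalarTower F O O]

include h

theorem ne_zero_of_mul_notMem_span {x y : O} (hxy : x * y ∉ span F {1, x, y}) : x ≠ 0 := by
  rintro rfl
  simp at hxy

theorem notMem_span_of_mul_notMem_span {x y : O} (hx : x ∈ σ.im)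
    (hxy : x * y ∉ span F {1, x, y}) : y ∉ span F {x} := by
  intro hm
  obtain ⟨r, rfl⟩ := mem_span_singleton.1 hm
  apply hxy
  rw [mul_smul_comm, h.mul_self hx]
  exact smul_mem _ _ (neg_mem (smul_mem _ _ (subset_span (by simp))))

/-- If `x y` is not in the span of `1, x, y`, then at most one block contains `x` and `y`. -/
theorem block_unique {x y : O} (hx : x ∈ σ.im) (hy : y ∈ σ.im)
    (hxy : x * y ∉ span F {1, x, y}) {B : Submodule F O} (hB : B ∈ associativeBlocks σ)
    (hxB : x ∈ B) (hyB : y ∈ B) : B = span F {x * y, 1, x, y} ⊓ σ.im := by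
  have := h.finiteDimensional
  have h1 : (1 : O) ∉ B := fun h1 => h.one_notMem_im (hB.1 h1)
  have h1xy : (1 : O) ∉ span F {x, y} := fun h1 => h.one_notMem_im
    (span_le.2 (by rintro _ (rfl | rfl) <;> assumption) h1)
  have hS := h.isSubalgebra_scalars_sup hB.2.1 hB.2.2 h1
  have heq : span F {x * y, 1, x, y} = scalars F O ⊔ B := by
    apply eq_of_le_of_finrank_eq
    · rw [span_le]
      rintro _ (rfl | rfl | rfl | rfl)
      exacts [hS.2 _ (mem_sup_right hxB) _ (mem_sup_right hyB), hS.1, mem_sup_right hxB,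
        mem_sup_right hyB]
    · rw [finrank_span_insert hxy, finrank_span_insert h1xy,
        finrank_span_pair (h.ne_zero_of_mul_notMem_span hxy)
          (h.notMem_span_of_mul_notMem_span hx hxy), h.finrank_scalars_sup h1, hB.2.1]
  rw [heq, h.scalars_sup_inf_im hB.1]

/-- Independent imaginary `x, y` can be completed by some `z` with `(x y) z = x (y z)`. -/
theorem exists_associator_eq_zero {x y : O} (hx : x ∈ σ.im) (hy : y ∈ σ.im) (hx0 : x ≠ 0)
    (hyx : y ∉ span F {x}) : ∃ z ∈ σ.im, z ∉ span F {x, y} ∧ associator x y z = 0 := by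
  have := h.finiteDimensional
  have hS : ({x, y} : Set O) ⊆ σ.im := by rintro _ (rfl | rfl) <;> assumption
  have h1xy : (1 : O) ∉ span F {x, y} := fun h1 => h.one_notMem_im (span_le.2 hS h1)
  have hT : finrank F (span F ({1, x, y} : Set O)) = 3 := by
    rw [finrank_span_insert h1xy, finrank_span_pair hx0 hyx]
  let L : O →ₗ[F] O :=
    { toFun := fun z => associator x y z
      map_add' := associator_add_right x y
      map_smul' := fun r z => associator_smul_right r x y z }
  have hL : ∀ z, L z = associator x y z := fun _ => rfl
  have hTker : span F ({1, x, y} : Set O) ≤ LinearMap.ker L := by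
    rw [span_le]
    rintro _ (rfl | rfl | rfl)
    · simp [hL, associator]
    · exact h.associator_self_mid hx hy
    · exact h.associator_self_right hy _
  obtain ⟨C, hC⟩ := Submodule.exists_isCompl (span F ({1, x, y} : Set O))
  have hC5 : finrank F C = 5 := by
    have := finrank_add_eq_of_isCompl hC
    rw [h.finrank_eq] at this
    omega
  let c : Basis (Fin 5) F C := finBasisOfFinrankEq F C hC5
  -- Gram matrix of the skew form `b([x, y, z], w)` on a complement of `span {1, x, y}`; its odd
  -- size makes it singular, and a kernel vector gives `z`.
  let M : Matrix (Fin 5) (Fin 5) F := Matrix.of fun i j => b (L (c i)) (c j)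
  have hM : M.transpose = -M := by
    ext i j
    exact h.form_associator hx hy _ _
  obtain ⟨v, hv0, hv⟩ :=
    Matrix.exists_mulVec_eq_zero_iff.2 (det_eq_zero_of_transpose_eq_neg (by decide) M hM)
  let z : C := ∑ j, v j • c j
  have hz0 : z ≠ 0 := by
    intro hz
    exact hv0 (funext fun j => Fintype.linearIndependent_iff.1 c.linearIndependent v hz j)
  have hcz : ∀ i, b (L (c i)) z = 0 := by
    intro i
    have := congrFun hv i
    simpa [Matrix.mulVec, dotProduct, M, z, mul_comm] using this
  have hker : C ≤ LinearMap.ker ((b.flip (z : O)).comp L) := by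
    intro w hw
    have hw' : w = ∑ i, c.repr ⟨w, hw⟩ i • (c i : O) := by
      have := congrArg (Subtype.val) (c.sum_repr ⟨w, hw⟩)
      simpa only [Submodule.coe_sum, Submodule.coe_smul] using this.symm
    rw [hw']
    refine sum_mem fun i _ => smul_mem _ _ ?_
    exact hcz i
  -- Orthogonality on the complement extends to all of `O`, because `L` kills `span {1, x, y}`.
  have hall : ∀ w, b (L w) z = 0 := by
    have htop : LinearMap.ker ((b.flip (z : O)).comp L) = ⊤ := by
      rw [eq_top_iff, ← hC.sup_eq_top]
      refine sup_le (fun w hw => ?_) hker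
      have : L w = 0 := hTker hw
      simp [this]
    intro w
    exact (htop.ge mem_top : w ∈ LinearMap.ker ((b.flip (z : O)).comp L))
  have hz : associator x y (z : O) = 0 :=
    h.nondeg _ fun w => by rw [h.form_associator hx hy, ← hL, hall, neg_zero]
  have hzT : (z : O) ∉ span F ({1, x, y} : Set O) := fun hm =>
    hz0 (Subtype.ext (disjoint_def.1 hC.disjoint _ hm z.2))
  obtain ⟨r, z', hz', hzz⟩ := h.exists_im (z : O)
  refine ⟨z', hz', fun hm => hzT ?_, ?_⟩
  · rw [hzz]
    exact add_mem (smul_mem _ _ (subset_span (by simp)))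
      (span_mono (Set.subset_insert _ _) hm)
  · rw [← hz, hzz, associator_add_right, associator_smul_one_right, zero_add]

theorem span_triple_mem_associativeBlocks {x y z : O} (hx : x ∈ σ.im) (hy : y ∈ σ.im)
    (hz : z ∈ σ.im) (hx0 : x ≠ 0) (hyx : y ∉ span F {x}) (hzxy : z ∉ span F {x, y})
    (h0 : associator x y z = 0) : span F {x, y, z} ∈ associativeBlocks σ := by
  have := h.finiteDimensional
  refine ⟨span_le.2 ?_, finrank_span_triple hx0 hyx hzxy,
    h.isAssociativeSubspace_span_triple hx hy hz h0⟩
  rintro _ (rfl | rfl | rfl) <;> assumption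

theorem isQCoveringDesign : IsQCoveringDesign 7 3 2 σ.im (associativeBlocks σ) := by
  have := h.finiteDimensional
  refine ⟨⟨inferInstance, h.finrank_im⟩, fun B hB => ⟨hB.1, hB.2.1⟩, fun T hT h2 => ?_⟩
  obtain ⟨x, hx, y, hy, hx0, hyx, rfl⟩ := exists_eq_span_pair h2
  obtain ⟨z, hz, hzxy, h0⟩ := h.exists_associator_eq_zero (hT hx) (hT hy) hx0 hyx
  refine ⟨span F {x, y, z},
    h.span_triple_mem_associativeBlocks (hT hx) (hT hy) hz hx0 hyx hzxy h0, span_mono ?_⟩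
  rintro _ (rfl | rfl) <;> simp

theorem not_isQCoveringDesign_of_ssubset {B' : Set (Submodule F O)}
    (hB' : B' ⊂ associativeBlocks σ) : ¬ IsQCoveringDesign 7 3 2 σ.im B' := by
  have := h.finiteDimensional
  rintro ⟨-, -, hcov⟩
  obtain ⟨B, hB, hBB'⟩ := Set.exists_of_ssubset hB'
  -- For this pair, `B` is the only block that can cover `span {x, y}`, so it cannot be omitted.
  obtain ⟨x, hx, y, hy, hxy⟩ := h.exists_mul_notMem_span hB
  obtain ⟨B₂, hB₂, hle⟩ := hcov (span F {x, y})
    (span_le.2 (by rintro _ (rfl | rfl); exacts [hB.1 hx, hB.1 hy]))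
    (finrank_span_pair (h.ne_zero_of_mul_notMem_span hxy)
      (h.notMem_span_of_mul_notMem_span (hB.1 hx) hxy))
  rw [h.block_unique (hB.1 hx) (hB.1 hy) hxy hB hx hy, ← h.block_unique (hB.1 hx) (hB.1 hy) hxy
    (hB'.1 hB₂) (hle (subset_span (by simp))) (hle (subset_span (by simp)))] at hBB'
  exact hBB' hB₂

/-! ### Division algebras and uniqueness of blocks -/

theorem form_conj (a : O) : b (σ.toLinearMap a) (σ.toLinearMap a) = b a a := by
  rw [h.conj_eq]
  simp [h.one_one, h.symm 1 a]
  ring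

theorem mul_conj_mul (a x : O) : a * (σ.toLinearMap a * x) = b a a • x := by
  have h1 := h.conj_mul_mul (σ.toLinearMap a) x
  rwa [show σ.toLinearMap (σ.toLinearMap a) = a from σ.invol' a, h.form_conj] at h1

theorem mul_conj_mul_right (a x : O) : (x * σ.toLinearMap a) * a = b a a • x := by
  have h1 := h.mul_mul_conj (σ.toLinearMap a) x
  rwa [show σ.toLinearMap (σ.toLinearMap a) = a from σ.invol' a, h.form_conj] at h1

/-- `O` is a division algebra exactly if its form is anisotropic. -/
theorem isDivisionAlgebra_iff : IsDivisionAlgebra O ↔ ∀ a : O, a ≠ 0 → b a a ≠ 0 := by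
  constructor
  · intro hD a ha h0
    have ha' : σ.toLinearMap a ≠ 0 := fun e => ha <| by
      rw [← show σ.toLinearMap (σ.toLinearMap a) = a from σ.invol' a, e, map_zero]
    refine ha ((hD _ ha').1.1 ?_)
    have := h.conj_mul_mul a 1
    rw [mul_one, h0, zero_smul] at this
    simpa using this
  · intro hn a ha
    have hne := hn a ha
    refine ⟨⟨fun x y hxy => ?_, fun y => ⟨(b a a)⁻¹ • (σ.toLinearMap a * y), ?_⟩⟩,
      ⟨fun x y hxy => ?_, fun y => ⟨(b a a)⁻¹ • (y * σ.toLinearMap a), ?_⟩⟩⟩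
    · have := congrArg (fun w => σ.toLinearMap a * w) hxy
      simp only [h.conj_mul_mul] at this
      exact smul_right_injective O hne this
    · simp only
      rw [mul_smul_comm, h.mul_conj_mul, inv_smul_smul₀ hne]
    · have := congrArg (fun w => w * σ.toLinearMap a) hxy
      simp only [h.mul_mul_conj] at this
      exact smul_right_injective O hne this
    · simp only
      rw [smul_mul_assoc, h.mul_conj_mul_right, inv_smul_smul₀ hne]

theorem mul_notMem_span_of_anisotropic (hn : ∀ a : O, a ≠ 0 → b a a ≠ 0) {x y : O}
    (hx : x ∈ σ.im) (hy : y ∈ σ.im) (hx0 : x ≠ 0) (hyx : y ∉ span F {x}) :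
    x * y ∉ span F {1, x, y} := by
  intro hm
  obtain ⟨p, q, hpq⟩ := h.exists_mul_add_eq hx hy hm
  have hu0 : x - q • (1 : O) ≠ 0 := by
    intro e
    rw [sub_eq_zero] at e
    have : q = 0 := by simpa [e, h.mem_im, h.one_one] using hx
    exact hx0 (by rw [e, this, zero_smul])
  -- Completing the product makes it scalar; multiplying by the conjugate of the anisotropic `x - q`
  -- then forces `y` into `span {1, x}`.
  have h1 : (x - q • (1 : O)) * (y - p • (1 : O)) = (p * q - b x y) • (1 : O) := by
    simp only [sub_mul, mul_sub, smul_mul_assoc, mul_smul_comm, one_mul, mul_one]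
    linear_combination (norm := module) hpq
  have h2 := h.conj_mul_mul (x - q • (1 : O)) (y - p • (1 : O))
  rw [h1, mul_smul_comm, mul_one, map_sub, h.conj_of_mem_im hx, map_smul,
    show σ.toLinearMap (1 : O) = 1 from σ.map_one] at h2
  refine hyx ((h.mem_span_one_insert (S := {x}) (by rintro _ rfl; exact hx) hy).1
    ((smul_mem_iff _ (hn _ hu0)).1 (mem_span_pair.2
      ⟨b (x - q • (1 : O)) (x - q • (1 : O)) * p - (p * q - b x y) * q, -(p * q - b x y), ?_⟩)))
  linear_combination (norm := module) h2

/-- Take a nonzero `c` orthogonal to `1` and `a`. Either `c` is isotropic, or `ac` is nonzero,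
imaginary and isotropic because `b(ac, ac) = b(a, a) b(c, c)`. -/
theorem exists_isotropic_im {a : O} (ha : a ≠ 0) (ha0 : b a a = 0) :
    ∃ x ∈ σ.im, x ≠ 0 ∧ b x x = 0 := by
  have := h.finiteDimensional
  obtain ⟨c, hc, hc0⟩ := exists_mem_notMem_span_singleton (F := F)
    (B := b.orthogonal (span F {1, a})) (by
      rw [h.finrank_orthogonal]
      classical
      have h2 := finrank_span_le_card (R := F) ({1, a} : Set O)
      rw [Set.toFinset_insert, Set.toFinset_singleton] at h2
      have := h2.trans Finset.card_le_two
      omega) 0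
  have hc1 : b 1 c = 0 := hc 1 (subset_span (by simp))
  have hca : b a c = 0 := hc a (subset_span (by simp))
  have hci : c ∈ σ.im := h.mem_im.2 (by rw [h.symm, hc1])
  by_cases hcc : b c c = 0
  · exact ⟨c, hci, fun e => hc0 (by simp [e]), hcc⟩
  · refine ⟨a * c, h.mem_im.2 ?_, h.mul_ne_zero_of_anisotropic ha hcc, ?_⟩
    · rw [h.form_mul_right hci, one_mul, hca, neg_zero]
    · rw [h.mul_left, h.conj_mul_mul, ha0, zero_smul, map_zero]

/-- Left multiplication by `x` squares to zero, so its kernel has dimension at least four and meets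
the imaginary hyperplane in dimension at least three. -/
theorem three_le_finrank_ker {x : O} (hx : x ∈ σ.im) (hxx : b x x = 0) :
    3 ≤ finrank F (LinearMap.ker (LinearMap.mulLeft F x) ⊓ σ.im : Submodule F O) := by
  have := h.finiteDimensional
  have h1 := (LinearMap.mulLeft F x).finrank_range_add_finrank_ker
  have h2 : LinearMap.range (LinearMap.mulLeft F x) ≤ LinearMap.ker (LinearMap.mulLeft F x) := by
    rintro _ ⟨y, rfl⟩
    simp [h.mul_mul_left hx, hxx]
  have h3 := finrank_mono h2
  have h4 := finrank_sup_add_finrank_inf_eq (LinearMap.ker (LinearMap.mulLeft F x)) σ.im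
  have h5 := finrank_le (LinearMap.ker (LinearMap.mulLeft F x) ⊔ σ.im)
  have h6 := h.finrank_im
  rw [h.finrank_eq] at h1 h5
  omega

theorem isotropic_of_mul_eq_zero {x y : O} (hx0 : x ≠ 0) (hxy : x * y = 0) : b y y = 0 := by
  by_contra hy
  exact h.mul_ne_zero_of_anisotropic hx0 hy hxy

theorem mul_eq_zero_swap {x y : O} (hx : x ∈ σ.im) (hy : y ∈ σ.im) (hxy : x * y = 0) :
    y * x = 0 ∧ b x y = 0 := by
  have h1 := h.form_mul_one hx y
  rw [hxy, map_zero, LinearMap.zero_apply, eq_comm, neg_eq_zero] at h1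
  have h2 := h.mul_add_mul hx hy
  rw [hxy, h1] at h2
  exact ⟨by simpa using h2, h1⟩

theorem mul_eq_zero_of_span {S : Set O} (hS : ∀ x ∈ S, ∀ y ∈ S, x * y = 0) :
    ∀ x ∈ span F S, ∀ y ∈ span F S, x * y = 0 := by
  intro x hx y hy
  induction hx using span_induction with
  | zero => simp
  | add u v _ _ hu hv => rw [add_mul, hu, hv, add_zero]
  | smul r u _ hu => rw [smul_mul_assoc, hu, smul_zero]
  | mem x hx =>
    induction hy using span_induction with
    | zero => simp
    | add u v _ _ hu hv => rw [mul_add, hu, hv, add_zero]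
    | smul r u _ hu => rw [mul_smul_comm, hu, smul_zero]
    | mem y hy => exact hS x hx y hy

/-- An isotropic form yields a two-dimensional space of imaginary elements in two blocks. -/
theorem not_isSubspaceDesign_of_isotropic {x : O} (hx : x ∈ σ.im) (hx0 : x ≠ 0)
    (hxx : b x x = 0) : ¬ IsSubspaceDesign 2 7 3 1 σ.im (associativeBlocks σ) := by
  have := h.finiteDimensional
  rintro ⟨-, -, hD⟩
  have hK := h.three_le_finrank_ker hx hxx
  obtain ⟨y, ⟨hxy, hy⟩, hyx⟩ := exists_mem_notMem_span_singleton (le_of_lt hK) x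
  replace hxy : x * y = 0 := hxy
  obtain ⟨hyx0, hbxy⟩ := h.mul_eq_zero_swap hx hy hxy
  have hyy := h.isotropic_of_mul_eq_zero hx0 hxy
  obtain ⟨z, ⟨hxz, hz⟩, hzxy⟩ := exists_mem_notMem_span_pair hK x y
  replace hxz : x * z = 0 := hxz
  obtain ⟨w, ⟨hyw, hw⟩, hwxy⟩ := exists_mem_notMem_span_pair (h.three_le_finrank_ker hy hyy) x y
  replace hyw : y * w = 0 := hyw
  have hz0 : associator x y z = 0 := by
    have := h.mul_mul_add_left hx hy z
    rw [hxz, mul_zero, add_zero, hbxy, mul_zero, zero_smul, neg_zero] at this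
    rw [associator, hxy, this, zero_mul, sub_zero]
  have hw0 : associator x y w = 0 := by rw [associator, hxy, hyw, zero_mul, mul_zero, sub_zero]
  have hB₁ := h.span_triple_mem_associativeBlocks hx hy hz hx0 hyx hzxy hz0
  have hB₂ := h.span_triple_mem_associativeBlocks hx hy hw hx0 hyx hwxy hw0
  have hone := hD (span F {x, y}) (span_le.2 (by rintro _ (rfl | rfl) <;> assumption))
    (finrank_span_pair hx0 hyx)
  have heq : span F {x, y, z} = span F {x, y, w} :=
    Set.encard_le_one_iff.1 (hone.trans Nat.cast_one).le _ _
      ⟨hB₁, span_mono (by rintro _ (rfl | rfl) <;> simp)⟩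
      ⟨hB₂, span_mono (by rintro _ (rfl | rfl) <;> simp)⟩
  have hyz : y * z = 0 := by
    have hm : z ∈ span F {x, y, w} := heq ▸ subset_span (by simp)
    obtain ⟨p, q, r, rfl⟩ := mem_span_triple.1 hm
    rw [mul_add, mul_add, mul_smul_comm, mul_smul_comm, mul_smul_comm, hyx0, hyw, h.mul_self hy,
      hyy]
    simp
  have hzz := h.isotropic_of_mul_eq_zero hx0 hxz
  have hprod := h.mul_eq_zero_of_span (S := {x, y, z}) (by
    rintro _ (rfl | rfl | rfl) _ (rfl | rfl | rfl) <;>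
    first
    | assumption
    | exact (h.mul_eq_zero_swap ‹_› ‹_› ‹_›).1
    | (rw [h.mul_self ‹_›]; simp [*]))
  refine h.not_mul_eq_zero hB₁.1 hB₁.2.1 fun u hu v hv => ⟨hprod u hu v hv, ?_⟩
  exact (h.mul_eq_zero_swap (hB₁.1 hu) (hB₁.1 hv) (hprod u hu v hv)).2

theorem isSubspaceDesign_iff :
    IsSubspaceDesign 2 7 3 1 σ.im (associativeBlocks σ) ↔ IsDivisionAlgebra O := by
  have := h.finiteDimensional
  rw [h.isDivisionAlgebra_iff]
  constructor
  · intro hD a ha ha0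
    obtain ⟨x, hx, hx0, hxx⟩ := h.exists_isotropic_im ha ha0
    exact h.not_isSubspaceDesign_of_isotropic hx hx0 hxx hD
  · intro hn
    obtain ⟨hV, hB, hcov⟩ := h.isQCoveringDesign
    refine ⟨hV, hB, fun T hT h2 => ?_⟩
    obtain ⟨B, hB, hTB⟩ := hcov T hT h2
    obtain ⟨x, hx, y, hy, hx0, hyx, rfl⟩ := exists_eq_span_pair h2
    have hxy := h.mul_notMem_span_of_anisotropic hn (hT hx) (hT hy) hx0 hyx
    rw [Nat.cast_one, Set.encard_eq_one]
    refine ⟨B, Set.eq_singleton_iff_unique_mem.2 ⟨⟨hB, hTB⟩, fun B' hB' => ?_⟩⟩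
    rw [h.block_unique (hT hx) (hT hy) hxy hB (hTB hx) (hTB hy),
      h.block_unique (hT hx) (hT hy) hxy hB'.1 (hB'.2 hx) (hB'.2 hy)]

end IsCayleyForm
end CayleyDickson

theorem mainTheorem6 {F : Type*} [Field F] [NeZero (2 : F)] {O : Type*} [NonAssocRing O]
    [Module F O] [SMulCommClass F O O] [IsScalarTower F O O]
    (σ : CayleyDickson.StrongInvolution F O) (hO : CayleyDickson.IsCayleyAlgebra σ) :
    (∀ A : Submodule F O, Module.finrank F A = 3 → CayleyDickson.IsAssociativeSubspace A →
      (1 : O) ∉ A →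
        Disjoint (CayleyDickson.scalars F O) A ∧
        CayleyDickson.IsSubalgebra (CayleyDickson.scalars F O ⊔ A) ∧
        Module.finrank F (CayleyDickson.scalars F O ⊔ A : Submodule F O) = 4 ∧
        CayleyDickson.IsAssociativeSubspace (CayleyDickson.scalars F O ⊔ A)) ∧
    CayleyDickson.subalgebraBlocks σ = CayleyDickson.associativeBlocks σ ∧
    CayleyDickson.IsQCoveringDesign 7 3 2 σ.im (CayleyDickson.associativeBlocks σ) ∧
    (∀ B' : Set (Submodule F O), B' ⊂ CayleyDickson.associativeBlocks σ →
      ¬ CayleyDickson.IsQCoveringDesign 7 3 2 σ.im B') ∧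
    (CayleyDickson.IsSubspaceDesign 2 7 3 1 σ.im (CayleyDickson.associativeBlocks σ) ↔
      CayleyDickson.IsDivisionAlgebra O) := by
  obtain ⟨b, h⟩ := hO.exists_form
  refine ⟨fun A h3 hA h1 => ⟨?_, h.isSubalgebra_scalars_sup h3 hA h1,
    by rw [h.finrank_scalars_sup h1, h3], h.isAssociativeSubspace_scalars_sup hA⟩,
    h.subalgebraBlocks_eq, h.isQCoveringDesign, fun _ => h.not_isQCoveringDesign_of_ssubset,
    h.isSubspaceDesign_iff⟩
  exact (Submodule.disjoint_span_singleton' h.one_ne_zero).2 h1 |>.symm
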